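/- Let $p\ge 1$ be an integer and let $r(z)\in\mathbb C(z)$ be a rational function with $r(z)=O(z^{-2})$ as $z\to\infty$. Let $T$ be the (finite) set of poles of $r$, and assume that $0\notin T$ and that $n\notin T$ and $\pm(n-\tfrac12)\notin T$ for every integer $n\ge 1$. For integers $n\ge 0$ and $s\ge 1$ put $$h_n^{(s)}=\sum_{k=1}^n\frac1{(k-\frac12)^s},\qquad \widetilde t(s)=\sum_{n=1}^\infty\frac1{(n-\frac12)^s}\ (s\ge 2),\qquad \widetilde t(1):=0,\qquad \widetilde t(\overline{s})=\sum_{n=1}^\infty\frac{(-1)^n}{(n-\frac12)^s}\ (s\ge1),$$ let $\Psi$ be the meromorphic function on $\mathbb C$ given by $$\Psi(-z)=\frac1{z+\frac12}+\sum_{k=1}^\infty\left(\frac1{k-\frac12}-\frac1{k-\frac12-z}\right),$$ let $\Psi^{(p-1)}(\tfrac12-z)$ denote its $(p-1)$-st derivative evaluated at $\tfrac12-z$, and define $$g(z)=\frac{\pi\,\Psi^{(p-1)}(\frac12-z)}{\cos(\pi z)\,(p-1)!}\,r(z).$$ Then all the infinite series over $n$ below that involve $r$ or its derivatives converge absolutely,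 and $$\sum_{n=1}^\infty\Big((-1)^p\,\widetilde t(p)+h_n^{(p)}\Big)(-1)^n r\big(n-\tfrac12\big)-(-1)^p\sum_{n=1}^\infty\Big(\widetilde t(p)-h_{n-1}^{(p)}\Big)(-1)^n r\big(\tfrac12-n\big)$$ $$-2\sum_{k=0}^{\lfloor (p-1)/2\rfloor}\frac{\widetilde t(\overline{2k+1})}{(p-1-2k)!}\sum_{n=0}^\infty(-1)^n r^{(p-1-2k)}(n)+\sum_{\beta\in T}\operatorname{Res}\big(g(z),\beta\big)=0 ,$$ where $r^{(j)}$ is the $j$-th derivative of $r$ and $\operatorname{Res}(g(z),\beta)$ is the residue of $g$ at $\beta$. -/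

import Mathlib

open Filter Topology

namespace EulerTSum

noncomputable section

/-- The odd harmonic number `h_n^{(p)} = ∑_{k=1}^n 1/(k-1/2)^p`; in particular `h_0^{(p)} = 0`. -/
def oddHarmonic (p n : ℕ) : ℝ :=
  ∑ k ∈ Finset.Icc 1 n, 1 / ((k : ℝ) - 1 / 2) ^ p

/-- The value `t̃(s) = ∑_{n ≥ 1} 1/(n-1/2)^s` for `s ≥ 2`, with the convention `t̃(1) = 0`. -/
def tTilde (s : ℕ) : ℝ :=
  if s = 1 then 0 else ∑' n : ℕ+, 1 / ((n : ℝ) - 1 / 2) ^ s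

/-- The alternating value with a barred argument, `∑_{n ≥ 1} (-1)^n/(n-1/2)^s`, `s ≥ 1`, as the
limit of its partial sums (the series converges only conditionally for `s = 1`). -/
def tTildeBar (s : ℕ) : ℝ :=
  limUnder atTop fun N : ℕ => ∑ n ∈ Finset.Icc 1 N, (-1 : ℝ) ^ n / ((n : ℝ) - 1 / 2) ^ s

/-- The series defining `tTildeBar s` converges for every `s ≥ 1`. -/
theorem tendsto_tTildeBar {s : ℕ} (hs : 1 ≤ s) :
    Tendsto (fun N : ℕ => ∑ n ∈ Finset.Icc 1 N, (-1 : ℝ) ^ n / ((n : ℝ) - 1 / 2) ^ s)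
      atTop (𝓝 (tTildeBar s)) := by
  have hanti : Antitone fun n : ℕ => 1 / ((n : ℝ) + 1 / 2) ^ s := by
    intro a b hab
    have : (a : ℝ) ≤ b := by exact_mod_cast hab
    dsimp only
    gcongr
  have hlim : Tendsto (fun n : ℕ => 1 / ((n : ℝ) + 1 / 2) ^ s) atTop (𝓝 0) := by
    have h1 : Tendsto (fun n : ℕ => ((n : ℝ) + 1 / 2) ^ s) atTop atTop :=
      (tendsto_pow_atTop (by omega)).comp
        (tendsto_atTop_add_const_right _ _ tendsto_natCast_atTop_atTop)
    exact h1.inv_tendsto_atTop.congr fun n => (one_div _).symm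
  obtain ⟨l, hl⟩ := hanti.tendsto_alternating_series_of_tendsto_zero hlim
  refine tendsto_nhds_limUnder ⟨-l, ?_⟩
  refine hl.neg.congr fun N => ?_
  rw [← Finset.sum_neg_distrib, Finset.range_eq_Ico,
    ← Finset.Ico_add_one_right_eq_Icc, Finset.sum_Ico_eq_sum_range, Finset.sum_Ico_eq_sum_range]
  refine Finset.sum_congr (by simp) fun n _ => ?_
  push_cast
  rw [pow_add, zero_add, show (1 : ℝ) + n - 1 / 2 = n + 1 / 2 by ring]
  ring

/-- The function `Ψ`, in the variable `w = -z`: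
`Ψ(-z) = 1/(z+1/2) + ∑_{k ≥ 1} (1/(k-1/2) - 1/(k-1/2-z))`, which equals
`ψ(-z-1/2) - ψ(1/2)` with `ψ` the digamma function. -/
def Psi (w : ℂ) : ℂ :=
  1 / (-w + 1 / 2) + ∑' k : ℕ+, (1 / ((k : ℂ) - 1 / 2) - 1 / ((k : ℂ) - 1 / 2 + w))

/-- The function on `ℂ` given by a rational function (its values at the poles are irrelevant). -/
def ratFun (r : RatFunc ℂ) (z : ℂ) : ℂ := RatFunc.eval (RingHom.id ℂ) z r

/-- The poles of a rational function: the zeros of its denominator in lowest terms. -/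
def poles (r : RatFunc ℂ) : Finset ℂ := r.denom.roots.toFinset

/-- The residue of `f` at an isolated singularity `c`: the common value of
`(2πi)⁻¹ ∮_{|z-c|=ρ} f(z) dz` for all small `ρ > 0`. -/
def residue (f : ℂ → ℂ) (c : ℂ) : ℂ :=
  limUnder (𝓝[>] (0 : ℝ)) fun ρ => (2 * (Real.pi : ℂ) * Complex.I)⁻¹ * ∮ z in C(c, ρ), f z

/-- `g(z) = π Ψ^{(p-1)}(1/2-z) / (cos(πz) (p-1)!) · r(z)`, where `Ψ^{(p-1)}(1/2-z)` is the
`(p-1)`-st derivative of `Ψ` evaluated at `1/2-z`. -/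
def gFun (p : ℕ) (r : RatFunc ℂ) (z : ℂ) : ℂ :=
  (Real.pi : ℂ) * iteratedDeriv (p - 1) Psi (1 / 2 - z)
    / (Complex.cos ((Real.pi : ℂ) * z) * ((p - 1).factorial : ℂ)) * ratFun r z

end

end EulerTSum

open EulerTSum

/-! Contour integration with a digamma-type kernel. Put F(z) = Ψ^{(p-1)}(1/2-z)/(p-1)!. By
Mittag-Leffler, F(z) = ∑_{k≥0} (z-k)^{-p}, with the constants 1/(k+1/2) added to the terms when p =
1 (`polygammaNeg`, `iteratedDeriv_Psi`). So g = (π/cos πz)·F·r off the naturals, and g is integrated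
over the circles |z| = N+1/4. There π/cos πz is bounded, F = O(N^{3/4}) and r = O(N^{-2}), so the
integrals are O(N^{-1/4}) and the residues inside sum to 0 in the limit
(`tendsto_sum_residues_secPi_mul`).

There are three families of residues. At ±(n-1/2), n ≥ 1, the cosine has a simple zero and the
residue is ±(-1)^n F·r; F is evaluated there by F(z+1) = F(z) + (z+1)^{-p}, starting from F(-1/2) =
(-1)^p t̃(p). At a natural n the pole of F has order p, with principal part exactly (z-n)^{-p}, so
the residue is the Taylor coefficient of order p-1 of π r(z)/cos πz. The poles of r contribute their
residues unevaluated.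

The Taylor coefficients of π/cos πz come from the same limit theorem, applied with z^{-(i+1)} in
place of F·r: they are -(1+(-1)^i) times the alternating values, so only even i survive
(`iteratedDeriv_secPi_zero`). -/

noncomputable section

/-! ### Residues and the residue theorem on a disc. -/

/-- `f` has an isolated singularity at `c` with finite principal part and residue `a`. -/
def HasResidueAt (f : ℂ → ℂ) (c a : ℂ) : Prop :=
  ∃ (m : ℕ) (b : ℕ → ℂ) (h : ℂ → ℂ), AnalyticAt ℂ h c ∧ ∀ᶠ z in 𝓝[≠] c,
    f z = a * (z - c)⁻¹ + ∑ j ∈ Finset.range m, b j * (z - c) ^ (-(j + 2) : ℤ) + h z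

/-- The remainder is the m-fold iterated slope of `A` at c, whose value at c is the m-th Taylor
coefficient. Slopes are defined everywhere, so the identity holds for all z. -/
theorem exists_taylor_remainder {A : ℂ → ℂ} {c : ℂ} (hA : AnalyticAt ℂ A c) (m : ℕ) :
    ∃ h : ℂ → ℂ, AnalyticAt ℂ h c ∧ ∀ z, A z =
      ∑ j ∈ Finset.range m, iteratedDeriv j A c / (j.factorial : ℂ) * (z - c) ^ j
        + (z - c) ^ m * h z := by
  have hp := hA.hasFPowerSeriesAt
  set p := FormalMultilinearSeries.ofScalars ℂ (fun n ↦ iteratedDeriv n A c / (n.factorial : ℂ))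
    with hpdef
  have hcoeff : ∀ j, (Function.swap dslope c)^[j] A c = iteratedDeriv j A c / (j.factorial : ℂ) := by
    intro j
    have h1 := (HasFPowerSeriesAt.has_fpower_series_iterate_dslope_fslope j hp).coeff_zero 1
    rw [← h1, ← FormalMultilinearSeries.coeff, FormalMultilinearSeries.coeff_iterate_fslope]
    simp [hpdef, FormalMultilinearSeries.coeff_ofScalars]
  refine ⟨(Function.swap dslope c)^[m] A,
    (HasFPowerSeriesAt.has_fpower_series_iterate_dslope_fslope m hp).analyticAt, fun z => ?_⟩
  induction m with
  | zero => simp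
  | succ m ih =>
    rw [Finset.sum_range_succ, ← hcoeff m, Function.iterate_succ_apply']
    have h2 := sub_smul_dslope ((Function.swap dslope c)^[m] A) c z
    simp only [smul_eq_mul] at h2
    rw [ih]
    have h3 : (z - c) ^ (m + 1) * Function.swap dslope c ((Function.swap dslope c)^[m] A) z
      = (z - c) ^ m * ((Function.swap dslope c)^[m] A z - (Function.swap dslope c)^[m] A c) := by
      rw [← h2, pow_succ, mul_assoc]
    rw [h3]; ring

theorem HasResidueAt.of_pow {f A : ℂ → ℂ} {c : ℂ} (n : ℕ) (hA : AnalyticAt ℂ A c)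
    (hf : ∀ᶠ z in 𝓝[≠] c, f z = ((z - c) ^ (n + 1))⁻¹ * A z) :
    HasResidueAt f c (iteratedDeriv n A c / (n.factorial : ℂ)) := by
  obtain ⟨h, hh, hAh⟩ := exists_taylor_remainder hA (n + 1)
  refine ⟨n, fun j => iteratedDeriv (n - 1 - j) A c / ((n - 1 - j).factorial : ℂ), h, hh, ?_⟩
  filter_upwards [hf, self_mem_nhdsWithin] with z hz hzc
  have hne : z - c ≠ 0 := sub_ne_zero.mpr hzc
  rw [hz, hAh z, Finset.sum_range_succ, mul_add, mul_add, inv_mul_cancel_left₀ (pow_ne_zero _ hne)]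
  have e1 : ((z - c) ^ (n + 1))⁻¹ * (iteratedDeriv n A c / (n.factorial : ℂ) * (z - c) ^ n)
      = iteratedDeriv n A c / (n.factorial : ℂ) * (z - c)⁻¹ := by
    field_simp
    ring
  rw [e1]
  congr 1
  rw [add_comm]
  congr 1
  -- Taylor index n-1-j corresponds to the exponent -(j+2) after division by (z-c)^(n+1).
  rw [← Finset.sum_range_reflect, Finset.mul_sum]
  refine Finset.sum_congr rfl fun j hj => ?_
  have hj' := Finset.mem_range.mp hj
  rw [show (-(j + 2) : ℤ) = ((n - 1 - j : ℕ) : ℤ) - ((n + 1 : ℕ) : ℤ) by omega, zpow_sub₀ hne,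
    zpow_natCast, zpow_natCast]
  ring

theorem HasResidueAt.of_simple {f A : ℂ → ℂ} {c : ℂ} (hA : AnalyticAt ℂ A c)
    (hf : ∀ᶠ z in 𝓝[≠] c, f z = (z - c)⁻¹ * A z) : HasResidueAt f c (A c) := by
  have := HasResidueAt.of_pow (f := f) 0 hA (by simpa using hf)
  simpa using this

theorem MeromorphicAt.exists_hasResidueAt {f : ℂ → ℂ} {c : ℂ} (hf : MeromorphicAt f c) :
    ∃ a, HasResidueAt f c a := by
  obtain ⟨n, hn⟩ := hf
  -- The extra factor z - c raises the exponent n, possibly 0, to the n + 1 needed by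
  -- `HasResidueAt.of_pow`.
  refine ⟨_, HasResidueAt.of_pow n
    (A := fun z => (z - c) * ((z - c) ^ n • f z)) (by fun_prop) ?_⟩
  filter_upwards [self_mem_nhdsWithin] with z hz
  have hne : z - c ≠ 0 := sub_ne_zero.mpr hz
  simp only [smul_eq_mul]
  field_simp
  ring

theorem HasResidueAt.congr_add {f g k : ℂ → ℂ} {c a : ℂ} (hf : HasResidueAt f c a)
    (hk : AnalyticAt ℂ k c) (h : ∀ᶠ z in 𝓝[≠] c, g z = f z + k z) : HasResidueAt g c a := by
  obtain ⟨m, b, u, hu, he⟩ := hf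
  refine ⟨m, b, fun z => u z + k z, hu.add hk, ?_⟩
  filter_upwards [he, h] with z h1 h2
  rw [h2, h1]; ring

theorem circleIntegral_principalPart {s c : ℂ} {R : ℝ} (hs : s ∈ Metric.ball c R) (a : ℂ)
    (m : ℕ) (b : ℕ → ℂ) :
    CircleIntegrable (fun z => a * (z - s)⁻¹ + ∑ j ∈ Finset.range m,
      b j * (z - s) ^ (-(j + 2) : ℤ)) c R ∧
    (∮ z in C(c, R), (a * (z - s)⁻¹ + ∑ j ∈ Finset.range m, b j * (z - s) ^ (-(j + 2) : ℤ)))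
      = 2 * Real.pi * Complex.I * a := by
  have hR : 0 < R := dist_nonneg.trans_lt hs
  have hns : ∀ z ∈ Metric.sphere c R, z - s ≠ 0 := by
    rintro z hz h
    rw [sub_eq_zero] at h
    subst h
    exact absurd (Metric.mem_sphere.mp hz) (Metric.mem_ball.mp hs).ne
  have h1 : CircleIntegrable (fun z => a * (z - s)⁻¹) c R :=
    ContinuousOn.circleIntegrable hR.le (by fun_prop (disch := assumption))
  have h2 : ∀ j : ℕ, CircleIntegrable (fun z => b j * (z - s) ^ (-(j + 2) : ℤ)) c R := fun j =>
    ContinuousOn.circleIntegrable hR.le <| continuousOn_const.mul <|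
      ContinuousOn.zpow₀ (by fun_prop) _ fun z hz => Or.inl (hns z hz)
  have h3 : CircleIntegrable (fun z => ∑ j ∈ Finset.range m,
      b j * (z - s) ^ (-(j + 2) : ℤ)) c R := CircleIntegrable.fun_sum _ fun j _ => h2 j
  refine ⟨h1.add h3, ?_⟩
  rw [circleIntegral.integral_add h1 h3, circleIntegral.integral_fun_sum fun j _ => h2 j]
  rw [Finset.sum_eq_zero, circleIntegral.integral_const_mul,
    circleIntegral.integral_sub_inv_of_mem_ball hs]
  · ring
  · intro j _
    rw [circleIntegral.integral_const_mul, circleIntegral.integral_sub_zpow_of_ne (by omega),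
      mul_zero]

theorem analyticAt_principalPart {s t : ℂ} (h : t ≠ s) (a : ℂ) (m : ℕ) (b : ℕ → ℂ) :
    AnalyticAt ℂ (fun z => a * (z - s)⁻¹ + ∑ j ∈ Finset.range m,
      b j * (z - s) ^ (-(j + 2) : ℤ)) t := by
  have hne : t - s ≠ 0 := sub_ne_zero.mpr h
  have h0 : AnalyticAt ℂ (fun z => z - s) t := by fun_prop
  refine (analyticAt_const.mul (h0.inv hne)).add ?_
  refine Finset.analyticAt_fun_sum _ fun j _ => ?_
  exact analyticAt_const.mul (h0.zpow hne)

/-- Induction on the singular set: subtracting the principal part at one point removes that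
singularity, leaves the other residues unchanged, and only its (z-s)^{-1} term has a nonzero
integral. Cauchy's theorem is the base case. -/
theorem circleIntegral_eq_sum_residues {c : ℂ} {R : ℝ} (hR : 0 < R) (a : ℂ → ℂ) (S : Finset ℂ)
    {f : ℂ → ℂ} (hS : ∀ s ∈ S, s ∈ Metric.ball c R)
    (hf : ∀ z ∈ Metric.closedBall c R, z ∉ S → AnalyticAt ℂ f z)
    (ha : ∀ s ∈ S, HasResidueAt f s (a s)) :
    (∮ z in C(c, R), f z) = 2 * Real.pi * Complex.I * ∑ s ∈ S, a s := by
  induction S using Finset.induction_on generalizing f with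
  | empty =>
    simp only [Finset.sum_empty, mul_zero]
    refine Complex.circleIntegral_eq_zero_of_differentiable_on_off_countable hR.le
      Set.countable_empty (fun z hz => (hf z hz (by simp)).continuousAt.continuousWithinAt)
      fun z hz => (hf z (Metric.ball_subset_closedBall hz.1) (by simp)).differentiableAt
  | insert s S hsS ih =>
    have hsb := hS s (Finset.mem_insert_self _ _)
    obtain ⟨m, b, h, hh, he⟩ := ha s (Finset.mem_insert_self _ _)
    set P : ℂ → ℂ := fun z => a s * (z - s)⁻¹ + ∑ j ∈ Finset.range m,
      b j * (z - s) ^ (-(j + 2) : ℤ) with hP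
    have hPan : ∀ t, t ≠ s → AnalyticAt ℂ P t := fun t ht => analyticAt_principalPart ht _ _ _
    obtain ⟨hPi, hPv⟩ := circleIntegral_principalPart hsb (a s) m b
    -- The value of f at s is arbitrary; `h s` is the one that fills the removable singularity.
    set F : ℂ → ℂ := Function.update (fun z => f z - P z) s (h s) with hF
    have hFne : ∀ z, z ≠ s → F z = f z - P z := fun z hz => by simp [hF, hz]
    have hFs : AnalyticAt ℂ F s := by
      refine hh.congr ?_
      rw [eventually_nhdsWithin_iff] at he
      filter_upwards [he] with z hz
      by_cases hzs : z = s
      · simp [hF, hzs]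
      · rw [hFne z hzs, hz hzs]; simp [hP]
    have hFev : ∀ t, t ≠ s → F =ᶠ[𝓝 t] fun z => f z - P z := fun t ht => by
      filter_upwards [isOpen_ne.mem_nhds ht] with z hz using hFne z hz
    have key := ih (f := F) (fun t ht => hS t (Finset.mem_insert_of_mem ht))
      (fun z hz hzS => by
        by_cases hzs : z = s
        · rw [hzs]; exact hFs
        · exact ((hf z hz (by simp [hzs, hzS])).sub (hPan z hzs)).congr (hFev z hzs).symm)
      (fun t ht => by
        have hts : t ≠ s := fun h => hsS (h ▸ ht)
        refine (ha t (Finset.mem_insert_of_mem ht)).congr_add (hPan t hts).neg ?_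
        filter_upwards [(hFev t hts).filter_mono nhdsWithin_le_nhds] with z hz
        rw [hz]; simp [sub_eq_add_neg])
    have hsph : ∀ z ∈ Metric.sphere c R, ∀ t ∈ insert s S, z ≠ t := by
      rintro z hz t ht rfl
      exact absurd (Metric.mem_sphere.mp hz) (Metric.mem_ball.mp (hS z ht)).ne
    have hfi : CircleIntegrable f c R := by
      refine ContinuousOn.circleIntegrable hR.le fun z hz => ?_
      exact (hf z (Metric.sphere_subset_closedBall hz)
        (fun hzS => hsph z hz z hzS rfl)).continuousAt.continuousWithinAt
    have e1 : (∮ z in C(c, R), F z) = ∮ z in C(c, R), (f z - P z) :=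
      circleIntegral.integral_congr hR.le fun z hz =>
        hFne z (hsph z hz s (Finset.mem_insert_self _ _))
    rw [circleIntegral.integral_sub hfi hPi, hPv, key] at e1
    rw [Finset.sum_insert hsS, mul_add, e1]; ring

theorem HasResidueAt.eventually_analyticAt {f : ℂ → ℂ} {c a : ℂ} (h : HasResidueAt f c a) :
    ∀ᶠ z in 𝓝[≠] c, AnalyticAt ℂ f z := by
  obtain ⟨m, b, u, hu, he⟩ := h
  have h1 := eventually_eventually_nhdsWithin.mpr he
  filter_upwards [h1, hu.eventually_analyticAt.filter_mono nhdsWithin_le_nhds,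
    self_mem_nhdsWithin] with z hz hz2 hz3
  rw [isOpen_compl_singleton.nhdsWithin_eq hz3] at hz
  exact ((analyticAt_principalPart hz3 a m b).add hz2).congr (hz.mono fun w hw => hw.symm)

theorem HasResidueAt.residue_eq {f : ℂ → ℂ} {c a : ℂ} (h : HasResidueAt f c a) :
    residue f c = a := by
  refine Tendsto.limUnder_eq ?_
  refine Tendsto.congr' ?_ tendsto_const_nhds
  have h1 := h.eventually_analyticAt
  rw [eventually_nhdsWithin_iff, Metric.eventually_nhds_iff] at h1
  obtain ⟨ε, hε, h1⟩ := h1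
  filter_upwards [Ioo_mem_nhdsGT hε] with ρ hρ
  have key := circleIntegral_eq_sum_residues hρ.1 (fun _ => a) {c} (f := f) (c := c)
    (by simp [hρ.1])
    (fun z hz hzc => h1 (lt_of_le_of_lt hz hρ.2) (by simpa using hzc)) (by simpa using h)
  rw [key]
  have : (Real.pi : ℂ) ≠ 0 := by exact_mod_cast Real.pi_ne_zero
  have hI := Complex.I_ne_zero
  rw [Finset.sum_singleton]
  field_simp

/-! ### The Mittag-Leffler series: convergence, derivatives, principal parts. -/

/-- The `k`-th term of the Mittag-Leffler series of `z ↦ ψ^{(p-1)}(-z) / (p-1)!`. -/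
def polygammaTerm (p k : ℕ) (z : ℂ) : ℂ :=
  ((z - k) ^ p)⁻¹ + if p = 1 then ((k : ℂ) + 1 / 2)⁻¹ else 0

/-- The normalised polygamma function `z ↦ ψ^{(p-1)}(-z) / (p-1)!`, with `ψ(1/2)` subtracted
when `p = 1`. -/
def polygammaNeg (p : ℕ) (z : ℂ) : ℂ := ∑' k : ℕ, polygammaTerm p k z

theorem natCast_add_half_ne_zero (k : ℕ) : (k : ℂ) + 1 / 2 ≠ 0 := by
  intro h
  have := congrArg Complex.re h
  simp at this
  have h2 : (0 : ℝ) ≤ k := k.cast_nonneg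
  linarith

theorem norm_natCast_add_half (k : ℕ) : ‖(k : ℂ) + 1 / 2‖ = k + 1 / 2 := by
  rw [show (k : ℂ) + 1 / 2 = ((k + 1 / 2 : ℝ) : ℂ) by push_cast; ring, Complex.norm_real,
    Real.norm_of_nonneg (by positivity)]

/-- Combining the two fractions exhibits the quadratic decay in k that makes the case p = 1
converge. -/
theorem polygammaTerm_one {k : ℕ} {z : ℂ} (h : z ≠ k) :
    polygammaTerm 1 k z = (z + 1 / 2) * ((z - k)⁻¹ * ((k : ℂ) + 1 / 2)⁻¹) := by
  have h1 := natCast_add_half_ne_zero k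
  have h2 : z - k ≠ 0 := sub_ne_zero.mpr h
  simp only [polygammaTerm, if_true, pow_one]
  rw [show z + 1 / 2 = (z - k) + (k + 1 / 2) by ring]
  generalize (k : ℂ) + 1 / 2 = y at *
  field_simp
  ring

/-- Dropping 2M terms keeps the remaining poles at distance at least k + M ≥ k + 1 from the disc |z|
≤ M, so the majorant is uniform there. -/
theorem norm_polygammaTerm_tail {p : ℕ} (hp : 1 ≤ p) {M : ℕ} (hM : 1 ≤ M) {z : ℂ}
    (hz : ‖z‖ ≤ M) (k : ℕ) :
    ‖polygammaTerm p (k + 2 * M) z‖ ≤ (M + 1) * (((k : ℝ) + 1) ^ 2)⁻¹ := by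
  have hM' : (1 : ℝ) ≤ M := by exact_mod_cast hM
  have hd : (k : ℝ) + 1 ≤ ‖z - ((k + 2 * M : ℕ) : ℂ)‖ := by
    have := norm_sub_norm_le ((k + 2 * M : ℕ) : ℂ) z
    rw [Complex.norm_natCast, norm_sub_rev] at this
    push_cast at this ⊢
    linarith
  have hpos : (0 : ℝ) < k + 1 := by positivity
  rcases hp.eq_or_lt with rfl | hp2
  · have hne : z ≠ ((k + 2 * M : ℕ) : ℂ) := by
      intro h; rw [h, sub_self, norm_zero] at hd; linarith
    rw [polygammaTerm_one hne, norm_mul, norm_mul, norm_inv, norm_inv, norm_natCast_add_half, sq,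
      mul_inv]
    have h1 : ‖z + 1 / 2‖ ≤ M + 1 := by
      refine (norm_add_le _ _).trans ?_
      norm_num
      linarith
    have h2 : (k : ℝ) + 1 ≤ ((k + 2 * M : ℕ) : ℝ) + 1 / 2 := by push_cast; linarith
    gcongr
  · rw [polygammaTerm, if_neg (by omega), add_zero, norm_inv, norm_pow]
    have h1 : ((k : ℝ) + 1) ^ 2 ≤ ‖z - ((k + 2 * M : ℕ) : ℂ)‖ ^ p :=
      (pow_le_pow_right₀ (by linarith [k.cast_nonneg (α := ℝ)]) hp2).trans (by gcongr)
    calc (‖z - ((k + 2 * M : ℕ) : ℂ)‖ ^ p)⁻¹ ≤ (((k : ℝ) + 1) ^ 2)⁻¹ := by gcongr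
      _ ≤ _ := le_mul_of_one_le_left (by positivity) (by linarith)

theorem summable_inv_succ_sq : Summable fun k : ℕ => (((k : ℝ) + 1) ^ 2)⁻¹ := by
  have := (summable_nat_add_iff 1).mpr (Real.summable_nat_pow_inv.mpr one_lt_two)
  simpa using this

theorem summable_polygammaTerm_tail {p : ℕ} (hp : 1 ≤ p) {M : ℕ} (hM : 1 ≤ M) {z : ℂ}
    (hz : ‖z‖ ≤ M) : Summable fun k => polygammaTerm p (k + 2 * M) z :=
  Summable.of_norm_bounded (summable_inv_succ_sq.mul_left _) (norm_polygammaTerm_tail hp hM hz)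

theorem exists_nat_norm_lt (z : ℂ) : ∃ M : ℕ, 1 ≤ M ∧ ‖z‖ < M := by
  obtain ⟨M, hM⟩ := exists_nat_gt ‖z‖
  refine ⟨M, ?_, hM⟩
  have : (0 : ℝ) < M := (norm_nonneg z).trans_lt hM
  exact_mod_cast this

theorem summable_polygammaTerm {p : ℕ} (hp : 1 ≤ p) (z : ℂ) :
    Summable fun k => polygammaTerm p k z := by
  obtain ⟨M, hM, hz⟩ := exists_nat_norm_lt z
  exact (summable_nat_add_iff (2 * M)).mp (summable_polygammaTerm_tail hp hM hz.le)

theorem hasDerivAt_polygammaTerm {p k : ℕ} (hp : 1 ≤ p) {z : ℂ} (h : z ≠ k) :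
    HasDerivAt (polygammaTerm p k) (-p * polygammaTerm (p + 1) k z) z := by
  have hne : z - k ≠ 0 := sub_ne_zero.mpr h
  have h1 : HasDerivAt (fun z : ℂ => (z - k) ^ p) (p * (z - k) ^ (p - 1) * 1) z :=
    ((hasDerivAt_id z).sub_const (k : ℂ)).pow p
  refine ((h1.inv (pow_ne_zero _ hne)).add_const _).congr_deriv ?_
  rw [polygammaTerm, if_neg (by omega)]
  obtain ⟨m, rfl⟩ : ∃ m, p = m + 1 := ⟨p - 1, by omega⟩
  rw [Nat.add_sub_cancel]
  field_simp
  ring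

theorem hasDerivAt_polygammaNeg_tail {p : ℕ} (hp : 1 ≤ p) {M : ℕ} (hM : 1 ≤ M) {z : ℂ}
    (hz : ‖z‖ < M) : HasDerivAt (fun z => ∑' k, polygammaTerm p (k + 2 * M) z)
      (-p * ∑' k, polygammaTerm (p + 1) (k + 2 * M) z) z := by
  rw [← tsum_mul_left]
  have hmem : ∀ {y : ℂ}, y ∈ Metric.ball (0 : ℂ) M → ‖y‖ < M := fun h => by simpa using h
  refine hasDerivAt_tsum_of_isPreconnected
    (g := fun k => polygammaTerm p (k + 2 * M))
    (g' := fun k y => -p * polygammaTerm (p + 1) (k + 2 * M) y)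
    (u := fun k : ℕ => p * ((M + 1) * (((k : ℝ) + 1) ^ 2)⁻¹)) (t := Metric.ball 0 M) (y₀ := z)
    ((summable_inv_succ_sq.mul_left _).mul_left _) Metric.isOpen_ball
    (convex_ball _ _).isPreconnected ?_ ?_ (by simpa using hz)
    (summable_polygammaTerm_tail hp hM hz.le) (by simpa using hz)
  · intro k y hy
    refine hasDerivAt_polygammaTerm hp ?_
    rintro rfl
    have := hmem hy
    rw [Complex.norm_natCast] at this
    push_cast at this
    linarith [k.cast_nonneg (α := ℝ), M.cast_nonneg (α := ℝ)]
  · intro k y hy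
    rw [norm_mul, norm_neg, Complex.norm_natCast]
    gcongr
    exact norm_polygammaTerm_tail (by omega) hM (hmem hy).le k

theorem polygammaNeg_eq_sum_add_tail {p : ℕ} (hp : 1 ≤ p) (M : ℕ) (z : ℂ) :
    polygammaNeg p z = ∑ k ∈ Finset.range (2 * M), polygammaTerm p k z
      + ∑' k, polygammaTerm p (k + 2 * M) z :=
  ((summable_polygammaTerm hp z).sum_add_tsum_nat_add (2 * M)).symm

theorem hasDerivAt_polygammaNeg {p : ℕ} (hp : 1 ≤ p) {z : ℂ} (hz : ∀ k : ℕ, z ≠ k) :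
    HasDerivAt (polygammaNeg p) (-p * polygammaNeg (p + 1) z) z := by
  obtain ⟨M, hM, hzM⟩ := exists_nat_norm_lt z
  have h1 : polygammaNeg p = fun z => ∑ k ∈ Finset.range (2 * M), polygammaTerm p k z
      + ∑' k, polygammaTerm p (k + 2 * M) z := funext (polygammaNeg_eq_sum_add_tail hp M)
  rw [h1, polygammaNeg_eq_sum_add_tail (by omega) M, mul_add, Finset.mul_sum]
  exact (HasDerivAt.fun_sum fun k _ => hasDerivAt_polygammaTerm hp (hz k)).add
    (hasDerivAt_polygammaNeg_tail hp hM hzM)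

theorem analyticAt_polygammaNeg_tail {p : ℕ} (hp : 1 ≤ p) {M : ℕ} (hM : 1 ≤ M) {z : ℂ}
    (hz : ‖z‖ < M) : AnalyticAt ℂ (fun z => ∑' k, polygammaTerm p (k + 2 * M) z) z := by
  have : DifferentiableOn ℂ (fun z => ∑' k, polygammaTerm p (k + 2 * M) z)
      (Metric.ball (0 : ℂ) M) := fun y hy =>
    (hasDerivAt_polygammaNeg_tail hp hM
      (by simpa using hy)).differentiableAt.differentiableWithinAt
  exact this.analyticAt (Metric.isOpen_ball.mem_nhds (by simpa using hz))

theorem analyticAt_polygammaTerm {p k : ℕ} {z : ℂ} (h : z ≠ k) :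
    AnalyticAt ℂ (polygammaTerm p k) z := by
  have hne : (z - k) ^ p ≠ 0 := pow_ne_zero _ (sub_ne_zero.mpr h)
  have h1 : AnalyticAt ℂ (fun z : ℂ => (z - k) ^ p) z := by fun_prop
  exact (h1.inv hne).add analyticAt_const

theorem analyticAt_polygammaNeg {p : ℕ} (hp : 1 ≤ p) {z : ℂ} (hz : ∀ k : ℕ, z ≠ k) :
    AnalyticAt ℂ (polygammaNeg p) z := by
  obtain ⟨M, hM, hzM⟩ := exists_nat_norm_lt z
  have h1 : polygammaNeg p = fun z => ∑ k ∈ Finset.range (2 * M), polygammaTerm p k z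
      + ∑' k, polygammaTerm p (k + 2 * M) z := funext (polygammaNeg_eq_sum_add_tail hp M)
  rw [h1]
  exact (Finset.analyticAt_fun_sum _ fun k _ => analyticAt_polygammaTerm (hz k)).add
    (analyticAt_polygammaNeg_tail hp hM hzM)

theorem polygammaNeg_principalPart {p : ℕ} (hp : 1 ≤ p) (n : ℕ) :
    ∃ H : ℂ → ℂ, AnalyticAt ℂ H n ∧ ∀ z, polygammaNeg p z = ((z - n) ^ p)⁻¹ + H z := by
  set M := n + 1 with hMdef
  have hn : ‖(n : ℂ)‖ < (M : ℕ) := by rw [Complex.norm_natCast]; push_cast [hMdef]; linarith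
  refine ⟨fun z => (∑ k ∈ (Finset.range (2 * M)).erase n, polygammaTerm p k z
      + ∑' k, polygammaTerm p (k + 2 * M) z) + if p = 1 then ((n : ℂ) + 1 / 2)⁻¹ else 0, ?_, ?_⟩
  · refine ((Finset.analyticAt_fun_sum _ fun k hk => analyticAt_polygammaTerm ?_).add
      (analyticAt_polygammaNeg_tail hp (by omega) hn)).add analyticAt_const
    have := Finset.ne_of_mem_erase hk
    exact_mod_cast this.symm
  · intro z
    rw [polygammaNeg_eq_sum_add_tail hp M,
      ← Finset.add_sum_erase _ _ (Finset.mem_range.mpr (by omega : n < 2 * M))]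
    conv_lhs => rw [polygammaTerm]
    ring

/-! ### The shift relation, values at half-integers, and the link with Ψ. -/

theorem hasSum_sub_succ {u : ℕ → ℂ} (h : Summable fun k => u k - u (k + 1))
    (hu : Tendsto u atTop (𝓝 0)) : HasSum (fun k => u k - u (k + 1)) (u 0) := by
  rw [h.hasSum_iff_tendsto_nat]
  simp_rw [Finset.sum_range_sub']
  simpa using tendsto_const_nhds.sub hu

theorem tendsto_inv_natCast_add_half :
    Tendsto (fun k : ℕ => ((k : ℂ) + 1 / 2)⁻¹) atTop (𝓝 0) := by
  rw [tendsto_zero_iff_norm_tendsto_zero]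
  simp_rw [norm_inv, norm_natCast_add_half]
  exact (tendsto_atTop_add_const_right _ _ tendsto_natCast_atTop_atTop).inv_tendsto_atTop

theorem tendsto_inv_sub_natCast_pow {p : ℕ} (hp : 1 ≤ p) (z : ℂ) :
    Tendsto (fun k : ℕ => ((z - k) ^ p)⁻¹) atTop (𝓝 0) := by
  have h1 := ((summable_polygammaTerm le_rfl z).tendsto_atTop_zero.sub
    tendsto_inv_natCast_add_half).pow p
  simp only [sub_zero, zero_pow (by omega : p ≠ 0)] at h1
  refine h1.congr fun k => ?_
  simp [polygammaTerm]

/-- Replacing z by z + 1 shifts the poles by one index; the difference of the series telescopes to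
its first term, and the constants for p = 1 cancel. -/
theorem polygammaNeg_add_one {p : ℕ} (hp : 1 ≤ p) (z : ℂ) :
    polygammaNeg p (z + 1) = polygammaNeg p z + ((z + 1) ^ p)⁻¹ := by
  have h1 := summable_polygammaTerm hp (z + 1)
  have h2 := summable_polygammaTerm hp z
  set u : ℕ → ℂ := fun k => ((z + 1 - k) ^ p)⁻¹ with hu
  have e : (fun k => polygammaTerm p k (z + 1) - polygammaTerm p k z)
      = fun k => u k - u (k + 1) := by
    funext k
    simp only [polygammaTerm, hu]
    push_cast
    ring_nf
  have h3 := (h1.sub h2)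
  rw [e] at h3
  have h4 := (hasSum_sub_succ h3 (tendsto_inv_sub_natCast_pow hp _)).tsum_eq
  rw [← e, h1.tsum_sub h2] at h4
  simp only [hu, Nat.cast_zero, sub_zero] at h4
  rw [← h4, polygammaNeg, polygammaNeg]
  ring

/-- For p = 1 the normalising constants make every term vanish at -1/2, which is the convention
t̃(1) = 0. -/
theorem polygammaNeg_neg_half {p : ℕ} :
    polygammaNeg p (-(1 / 2)) = (-1) ^ p * (tTilde p : ℂ) := by
  rw [polygammaNeg, tTilde]
  split_ifs with h
  · subst h
    rw [Complex.ofReal_zero, mul_zero]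
    refine (tsum_congr fun k => ?_).trans tsum_zero
    simp only [polygammaTerm, if_true, pow_one]
    rw [show -(1 / 2 : ℂ) - k = -(k + 1 / 2) by ring, inv_neg, neg_add_cancel]
  · rw [Complex.ofReal_tsum, tsum_pnat_eq_tsum_succ
      (f := fun n : ℕ => ((1 / ((n : ℝ) - 1 / 2) ^ p : ℝ) : ℂ)), ← tsum_mul_left]
    refine tsum_congr fun k => ?_
    rw [polygammaTerm, if_neg h, add_zero, show -(1 / 2 : ℂ) - k = -1 * (k + 1 / 2) by ring,
      mul_pow, mul_inv, ← inv_pow]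
    push_cast
    rw [show (k : ℂ) + 1 - 1 / 2 = k + 1 / 2 by ring, one_div]
    norm_num

theorem oddHarmonic_succ (p n : ℕ) :
    oddHarmonic p (n + 1) = oddHarmonic p n + 1 / ((n : ℝ) + 1 / 2) ^ p := by
  rw [oddHarmonic, Finset.sum_Icc_succ_top (by omega), oddHarmonic]
  push_cast
  rw [show (n : ℝ) + 1 - 1 / 2 = n + 1 / 2 by ring]

theorem polygammaNeg_nat_sub_half {p : ℕ} (hp : 1 ≤ p) (n : ℕ) :
    polygammaNeg p (n - 1 / 2) = (-1) ^ p * (tTilde p : ℂ) + (oddHarmonic p n : ℂ) := by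
  induction n with
  | zero => simpa [oddHarmonic] using polygammaNeg_neg_half (p := p)
  | succ n ih =>
    rw [show ((n + 1 : ℕ) : ℂ) - 1 / 2 = ((n : ℂ) - 1 / 2) + 1 by push_cast; ring,
      polygammaNeg_add_one hp, ih, oddHarmonic_succ]
    push_cast
    rw [show (n : ℂ) - 1 / 2 + 1 = n + 1 / 2 by ring]
    ring

theorem polygammaNeg_neg_nat_add_half {p : ℕ} (hp : 1 ≤ p) (n : ℕ) :
    polygammaNeg p (-(n + 1 / 2)) = (-1) ^ p * ((tTilde p : ℂ) - (oddHarmonic p n : ℂ)) := by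
  induction n with
  | zero => simpa [oddHarmonic] using polygammaNeg_neg_half (p := p)
  | succ n ih =>
    have h := polygammaNeg_add_one hp (-(((n + 1 : ℕ) : ℂ) + 1 / 2))
    rw [show -(((n + 1 : ℕ) : ℂ) + 1 / 2) + 1 = -1 * ((n : ℂ) + 1 / 2) by push_cast; ring, mul_pow,
      mul_inv, neg_one_mul, ih] at h
    rw [oddHarmonic_succ]
    push_cast at h ⊢
    rw [← inv_pow, show (-1 : ℂ)⁻¹ = -1 by norm_num] at h
    linear_combination -h

/-- The two series use the same constants 1/(k+1/2), offset by one index; the offset telescopes to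
the constant 2 of the term k = 0. -/
theorem Psi_eq (w : ℂ) : Psi w = polygammaNeg 1 (1 / 2 - w) := by
  have hs := summable_polygammaTerm le_rfl (1 / 2 - w)
  set u : ℕ → ℂ := fun k => ((k : ℂ) + 1 / 2)⁻¹ with hu
  have e : ∀ k : ℕ, 1 / (((k + 1 : ℕ) : ℂ) - 1 / 2) - 1 / (((k + 1 : ℕ) : ℂ) - 1 / 2 + w)
      = polygammaTerm 1 (k + 1) (1 / 2 - w) + (u k - u (k + 1)) := by
    intro k
    simp only [polygammaTerm, hu, if_true, pow_one]
    push_cast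
    rw [show (1 / 2 : ℂ) - w - (k + 1) = -((k : ℂ) + 1 - 1 / 2 + w) by ring, inv_neg,
      show (k : ℂ) + 1 - 1 / 2 = k + 1 / 2 by ring]
    ring
  have hsu : Summable fun k => u k - u (k + 1) := by
    -- The difference of the series at -1/2 and at 1/2 is, from index 1 on, exactly the telescoping
    -- series.
    have h1 := (summable_polygammaTerm le_rfl (-(1 / 2) : ℂ)).sub
      (summable_polygammaTerm le_rfl (1 / 2 : ℂ))
    have h2 := (summable_nat_add_iff 1).mpr h1
    refine h2.congr fun k => ?_
    simp only [polygammaTerm, hu, if_true, pow_one]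
    push_cast
    rw [show (1 / 2 : ℂ) - (k + 1) = -(k + 1 / 2) by ring,
      show -(1 / 2 : ℂ) - (k + 1) = -(k + 1 + 1 / 2) by ring, inv_neg, inv_neg]
    ring
  rw [Psi, tsum_pnat_eq_tsum_succ
    (f := fun n : ℕ => 1 / ((n : ℂ) - 1 / 2) - 1 / ((n : ℂ) - 1 / 2 + w)), tsum_congr e,
    ((summable_nat_add_iff 1).mpr hs).tsum_add hsu,
    (hasSum_sub_succ hsu tendsto_inv_natCast_add_half).tsum_eq, polygammaNeg,
    hs.tsum_eq_zero_add]
  simp only [polygammaTerm, hu, if_true, pow_one]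
  norm_num
  ring

theorem isClosed_range_natCast : IsClosed (Set.range ((↑) : ℕ → ℂ)) := by
  simpa [Function.comp_def] using
    (Complex.isometry_ofReal.isClosedEmbedding.comp Nat.isClosedEmbedding_coe_real).isClosed_range

theorem iteratedDeriv_Psi (m : ℕ) {z : ℂ} (hz : ∀ k : ℕ, z ≠ k) :
    iteratedDeriv m Psi (1 / 2 - z) = (m.factorial : ℂ) * polygammaNeg (m + 1) z := by
  induction m generalizing z with
  | zero => simp [Psi_eq]
  | succ m ih =>
    rw [iteratedDeriv_succ]
    -- Differentiating the induction hypothesis requires it on a neighbourhood, hence the openness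
    -- of the complement of the naturals.
    have hop : IsOpen {w : ℂ | (1 / 2 - w) ∉ Set.range ((↑) : ℕ → ℂ)} :=
      isClosed_range_natCast.isOpen_compl.preimage (by fun_prop : Continuous fun w : ℂ => 1 / 2 - w)
    have hev : iteratedDeriv m Psi =ᶠ[𝓝 (1 / 2 - z)]
        fun w => (m.factorial : ℂ) * polygammaNeg (m + 1) (1 / 2 - w) := by
      filter_upwards [hop.mem_nhds (x := 1 / 2 - z) (by
        rintro ⟨k, hk⟩; exact hz k (by rw [hk]; ring))] with w hw
      rw [← ih (z := 1 / 2 - w) fun k hk => hw ⟨k, hk.symm⟩]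
      ring_nf
    have h1 : HasDerivAt (polygammaNeg (m + 1)) (-(m + 1 : ℕ) * polygammaNeg (m + 1 + 1) z)
        (1 / 2 - (1 / 2 - z)) := by
      rw [show (1 / 2 - (1 / 2 - z) : ℂ) = z by ring]
      exact hasDerivAt_polygammaNeg (by omega) hz
    have h2 := (h1.comp (1 / 2 - z) ((hasDerivAt_id (1 / 2 - z)).const_sub (1 / 2))).const_mul
      (m.factorial : ℂ)
    rw [hev.deriv_eq]
    refine h2.deriv.trans ?_
    rw [Nat.factorial_succ]
    push_cast
    ring

/-! ### Growth of the polygamma factor away from its poles. -/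

theorem summable_rpow_abs_add_one :
    Summable fun m : ℤ => (|(m : ℝ)| + 1) ^ (-(3 / 2) : ℝ) := by
  have h1 : Summable fun k : ℕ => ((k : ℝ) + 1) ^ (-(3 / 2) : ℝ) := by
    have := (summable_nat_add_iff 1).mpr
      (Real.summable_nat_rpow.mpr (by norm_num : (-(3 / 2) : ℝ) < -1))
    simpa using this
  refine Summable.of_nat_of_neg ?_ ?_ <;> simpa using h1

/-- With a = k+1 and d = |k-N|+1, the case p = 1 is of size N/(ad). Since ad ≥ N+1, a factor
(ad)^{-1/4} saves N^{-1/4}, and (ad)^{-3/4} ≤ a^{-3/2} + d^{-3/2} by AM-GM is summable in k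
uniformly in N. For p ≥ 2 the term d^{-3/2} alone suffices. -/
theorem norm_polygammaTerm_le {p : ℕ} (hp : 1 ≤ p) {N k : ℕ} {z : ℂ} (hz : ‖z‖ ≤ N + 1)
    (hzk : (|(k : ℝ) - N| + 1) / 8 ≤ ‖z - k‖) :
    ‖polygammaTerm p k z‖ ≤ 32 * 8 ^ p * ((N : ℝ) + 1) ^ (3 / 4 : ℝ) *
      (((k : ℝ) + 1) ^ (-(3 / 2) : ℝ) + (|(k : ℝ) - N| + 1) ^ (-(3 / 2) : ℝ)) := by
  set d := |(k : ℝ) - N| + 1 with hd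
  have hd1 : 1 ≤ d := by rw [hd]; linarith [abs_nonneg ((k : ℝ) - N)]
  have hk0 : (0 : ℝ) ≤ k := k.cast_nonneg
  have hN0 : (0 : ℝ) ≤ N := N.cast_nonneg
  set a := (k : ℝ) + 1 with ha
  have ha1 : 1 ≤ a := by linarith
  have hN1 : (1 : ℝ) ≤ ((N : ℝ) + 1) ^ (3 / 4 : ℝ) := Real.one_le_rpow (by linarith) (by norm_num)
  have hinv : ‖z - k‖⁻¹ ≤ 8 * d⁻¹ := by
    rw [show 8 * d⁻¹ = (d / 8)⁻¹ by field_simp]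
    gcongr
  rcases hp.eq_or_lt with rfl | hp2
  · have hne : z ≠ k := by
      rintro rfl
      rw [sub_self, norm_zero] at hzk
      linarith
    rw [polygammaTerm_one hne, norm_mul, norm_mul, norm_inv, norm_inv, norm_natCast_add_half]
    have h1 : ‖z + 1 / 2‖ ≤ 2 * ((N : ℝ) + 1) := by
      refine (norm_add_le _ _).trans ?_
      norm_num
      linarith
    have h2 : ((k : ℝ) + 1 / 2)⁻¹ ≤ 2 * a⁻¹ := by
      rw [show 2 * a⁻¹ = (a / 2)⁻¹ by field_simp]
      gcongr
      linarith
    have had : (N : ℝ) + 1 ≤ a * d := by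
      have : (N : ℝ) - k ≤ |(k : ℝ) - N| := by rw [abs_sub_comm]; exact le_abs_self _
      nlinarith
    have h3 : d⁻¹ * a⁻¹ ≤ ((N : ℝ) + 1) ^ (-(1 / 4) : ℝ) *
        (a ^ (-(3 / 2) : ℝ) + d ^ (-(3 / 2) : ℝ)) := by
      have e1 : d⁻¹ * a⁻¹ = (a * d) ^ (-(1 / 4) : ℝ) * (a * d) ^ (-(3 / 4) : ℝ) := by
        rw [← Real.rpow_add (by positivity), ← mul_inv, mul_comm d a, ← Real.rpow_neg_one]
        norm_num
      rw [e1]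
      have e2 : (a * d) ^ (-(1 / 4) : ℝ) ≤ ((N : ℝ) + 1) ^ (-(1 / 4) : ℝ) :=
        Real.rpow_le_rpow_of_nonpos (by linarith) had (by norm_num)
      have e3 : (a * d) ^ (-(3 / 4) : ℝ) ≤ a ^ (-(3 / 2) : ℝ) + d ^ (-(3 / 2) : ℝ) := by
        rw [Real.mul_rpow (by linarith) (by linarith),
          show (-(3 / 2) : ℝ) = -(3 / 4) + -(3 / 4) by norm_num, Real.rpow_add (by linarith),
          Real.rpow_add (by linarith)]
        have : 0 ≤ a ^ (-(3 / 4) : ℝ) := by positivity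
        have : 0 ≤ d ^ (-(3 / 4) : ℝ) := by positivity
        nlinarith [sq_nonneg (a ^ (-(3 / 4) : ℝ) - d ^ (-(3 / 4) : ℝ))]
      gcongr
    have h4 : ((N : ℝ) + 1) * ((N : ℝ) + 1) ^ (-(1 / 4) : ℝ) = ((N : ℝ) + 1) ^ (3 / 4 : ℝ) := by
      rw [← Real.rpow_one_add' (by linarith) (by norm_num)]
      norm_num
    calc ‖z + 1 / 2‖ * (‖z - k‖⁻¹ * ((k : ℝ) + 1 / 2)⁻¹)
        ≤ (2 * ((N : ℝ) + 1)) * ((8 * d⁻¹) * (2 * a⁻¹)) := by gcongr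
      _ = 32 * ((N : ℝ) + 1) * (d⁻¹ * a⁻¹) := by ring
      _ ≤ 32 * ((N : ℝ) + 1) * (((N : ℝ) + 1) ^ (-(1 / 4) : ℝ) *
        (a ^ (-(3 / 2) : ℝ) + d ^ (-(3 / 2) : ℝ))) := by gcongr
      _ = 32 * ((N : ℝ) + 1) ^ (3 / 4 : ℝ) * (a ^ (-(3 / 2) : ℝ) + d ^ (-(3 / 2) : ℝ)) := by
        rw [← h4]; ring
      _ ≤ _ := by
        gcongr
        norm_num
  · rw [polygammaTerm, if_neg (by omega), add_zero, norm_inv, norm_pow, ← inv_pow]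
    have h1 : (d⁻¹) ^ p ≤ d ^ (-(3 / 2) : ℝ) := by
      rw [← Real.rpow_natCast, ← Real.rpow_neg_one, ← Real.rpow_mul (by linarith)]
      refine Real.rpow_le_rpow_of_exponent_le hd1 ?_
      have : (2 : ℝ) ≤ p := by exact_mod_cast hp2
      linarith
    calc ‖z - k‖⁻¹ ^ p ≤ (8 * d⁻¹) ^ p := by gcongr
      _ = 1 * 8 ^ p * 1 * (0 + d⁻¹ ^ p) := by rw [mul_pow]; ring
      _ ≤ _ := by
        gcongr
        · norm_num
        · positivity

theorem exists_norm_polygammaNeg_le {p : ℕ} (hp : 1 ≤ p) : ∃ C : ℝ, 0 ≤ C ∧ ∀ (N : ℕ) (z : ℂ),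
    ‖z‖ ≤ N + 1 → (∀ k : ℕ, (|(k : ℝ) - N| + 1) / 8 ≤ ‖z - k‖) →
      ‖polygammaNeg p z‖ ≤ C * ((N : ℝ) + 1) ^ (3 / 4 : ℝ) := by
  -- Both families, centred at 0 and at N, are subfamilies of one series over ℤ, so the constant
  -- does not depend on N.
  set G : ℤ → ℝ := fun m => (|(m : ℝ)| + 1) ^ (-(3 / 2) : ℝ) with hG
  have hGs : Summable G := summable_rpow_abs_add_one
  have hG0 : ∀ m, 0 ≤ G m := fun m => by positivity
  have hinj : ∀ N : ℕ, Function.Injective fun k : ℕ => (k : ℤ) - N := fun N a b h => by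
    simpa using h
  refine ⟨32 * 8 ^ p * (2 * ∑' m, G m), mul_nonneg (by positivity) (mul_nonneg zero_le_two (tsum_nonneg hG0)),
    fun N z hz hzk => ?_⟩
  have hb : ∀ k : ℕ, ‖polygammaTerm p k z‖ ≤ 32 * 8 ^ p * ((N : ℝ) + 1) ^ (3 / 4 : ℝ) *
      (G ((k : ℤ) - (0 : ℕ)) + G ((k : ℤ) - N)) := fun k => by
    refine (norm_polygammaTerm_le hp hz (hzk k)).trans_eq ?_
    simp [hG]
  have hs : ∀ N : ℕ, Summable fun k : ℕ => G ((k : ℤ) - N) := fun N =>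
    hGs.comp_injective (hinj N)
  have hle : ∀ N : ℕ, ∑' k : ℕ, G ((k : ℤ) - N) ≤ ∑' m, G m := fun N =>
    tsum_comp_le_tsum_of_inj hGs hG0 (hinj N)
  have h1 := tsum_of_norm_bounded (((hs 0).add (hs N)).mul_left _).hasSum hb
  rw [tsum_mul_left, (hs 0).tsum_add (hs N)] at h1
  refine h1.trans ?_
  calc _ ≤ 32 * 8 ^ p * ((N : ℝ) + 1) ^ (3 / 4 : ℝ) * (∑' m, G m + ∑' m, G m) := by
        gcongr
        · exact hle 0
        · exact hle N
    _ = _ := by ring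

/-! ### The kernel π/cos πz on the circles |z| = N + 1/4, and its residues. -/

/-- The kernel `π / cos(π z)`. -/
def secPi (z : ℂ) : ℂ := (Real.pi : ℂ) / Complex.cos ((Real.pi : ℂ) * z)

theorem normSq_cos (z : ℂ) :
    Complex.normSq (Complex.cos z) = Real.cos z.re ^ 2 + Real.sinh z.im ^ 2 := by
  have h : Complex.cos z = ((Real.cos z.re * Real.cosh z.im : ℝ) : ℂ)
      + ((-(Real.sin z.re * Real.sinh z.im) : ℝ) : ℂ) * Complex.I := by
    rw [Complex.cos_eq]; push_cast; ring
  rw [h, Complex.normSq_add_mul_I]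
  have h1 := Real.cos_sq_add_sin_sq z.re
  have h2 := Real.cosh_sq z.im
  linear_combination Real.cos z.re ^ 2 * h2 + Real.sinh z.im ^ 2 * h1

/-- If |Im z| ≥ 1/2, the sinh term is already at least 1. Otherwise the radius N + 1/4 forces N ≤
|Re z| ≤ N + 1/4, where cos² ≥ 1/2. -/
theorem half_le_normSq_cos {N : ℕ} {z : ℂ} (hz : ‖z‖ = N + 1 / 4) :
    1 / 2 ≤ Complex.normSq (Complex.cos (Real.pi * z)) := by
  have hpi := Real.pi_gt_three
  rw [normSq_cos, Complex.re_ofReal_mul, Complex.im_ofReal_mul]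
  rcases le_or_gt (1 / 2) |z.im| with h | h
  · have h1 : Real.pi * |z.im| ≤ |Real.sinh (Real.pi * z.im)| := by
      rw [Real.abs_sinh, abs_mul, abs_of_pos Real.pi_pos]
      exact Real.self_le_sinh_iff.mpr (by positivity)
    have h2 : 1 ≤ |Real.sinh (Real.pi * z.im)| := by nlinarith
    have h3 : 1 ≤ Real.sinh (Real.pi * z.im) ^ 2 := by
      rw [← sq_abs]; exact one_le_pow₀ h2
    nlinarith [sq_nonneg (Real.cos (Real.pi * z.re))]
  · have hsq : |z.re| ^ 2 + |z.im| ^ 2 = (N + 1 / 4 : ℝ) ^ 2 := by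
      rw [← hz, Complex.sq_norm, Complex.normSq_apply, sq_abs, sq_abs]; ring
    have h0 := abs_nonneg z.im
    have h0' := abs_nonneg z.re
    have hN0 : (0 : ℝ) ≤ N := N.cast_nonneg
    have hup : |z.re| ≤ N + 1 / 4 := by nlinarith [sq_nonneg |z.im|]
    have hlow : (N : ℝ) ≤ |z.re| := by
      rcases Nat.eq_zero_or_pos N with rfl | hN
      · simp
      · have hN1 : (1 : ℝ) ≤ N := by exact_mod_cast hN
        nlinarith
    have hc : 0 ≤ Real.cos (2 * (Real.pi * z.re)) := by
      rw [← Real.cos_abs, show |2 * (Real.pi * z.re)| = 2 * (Real.pi * |z.re|) by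
        rw [abs_mul, abs_mul, abs_of_pos Real.pi_pos, abs_two],
        ← Real.cos_sub_nat_mul_two_pi _ N]
      apply Real.cos_nonneg_of_neg_pi_div_two_le_of_le <;> nlinarith
    rw [Real.cos_sq]
    nlinarith [sq_nonneg (Real.sinh (Real.pi * z.im))]

theorem norm_secPi_le {N : ℕ} {z : ℂ} (hz : ‖z‖ = N + 1 / 4) : ‖secPi z‖ ≤ 2 * Real.pi := by
  have h1 := half_le_normSq_cos hz
  rw [Complex.normSq_eq_norm_sq] at h1
  have h2 : 1 / 2 ≤ ‖Complex.cos (Real.pi * z)‖ := by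
    by_contra! h
    nlinarith [norm_nonneg (Complex.cos (Real.pi * z))]
  rw [secPi, norm_div, Complex.norm_real, Real.norm_of_nonneg Real.pi_pos.le,
    div_le_iff₀ (by linarith)]
  nlinarith [Real.pi_pos]

theorem analyticAt_secPi {z : ℂ} (hz : Complex.cos (Real.pi * z) ≠ 0) : AnalyticAt ℂ secPi z := by
  have : AnalyticAt ℂ (fun z => Complex.cos (Real.pi * z)) z := by fun_prop
  exact analyticAt_const.div this hz

theorem cos_pi_mul_eq_zero {z : ℂ} (hz : Complex.cos (Real.pi * z) = 0) :
    ∃ n : ℕ, z = n + 1 / 2 ∨ z = -(n + 1 / 2) := by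
  have hpi : (Real.pi : ℂ) ≠ 0 := by exact_mod_cast Real.pi_ne_zero
  obtain ⟨k, hk⟩ := Complex.cos_eq_zero_iff.mp hz
  have hz' : z = k + 1 / 2 := by
    have : (Real.pi : ℂ) * z = Real.pi * (k + 1 / 2) := by rw [hk]; ring
    exact mul_left_cancel₀ hpi this
  rcases le_or_gt 0 k with h | h
  · refine ⟨k.toNat, Or.inl ?_⟩
    rw [hz']
    have : ((k.toNat : ℤ) : ℂ) = k := by rw [Int.toNat_of_nonneg h]
    rw [← this, Int.cast_natCast]
  · refine ⟨(-k - 1).toNat, Or.inr ?_⟩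
    rw [hz']
    have : (((-k - 1).toNat : ℤ) : ℂ) = ((-k - 1 : ℤ) : ℂ) := by
      rw [Int.toNat_of_nonneg (by omega)]
    rw [Int.cast_natCast] at this
    rw [this]; push_cast; ring

theorem sin_pi_mul_nat_add_half (n : ℕ) :
    Complex.sin (Real.pi * ((n : ℂ) + 1 / 2)) = (-1) ^ n := by
  rw [show (Real.pi : ℂ) * (n + 1 / 2) = Real.pi / 2 + n * Real.pi by ring,
    Complex.sin_antiperiodic.add_nat_mul_eq, Complex.sin_pi_div_two, mul_one]

theorem cos_pi_mul_nat_add_half (n : ℕ) :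
    Complex.cos (Real.pi * ((n : ℂ) + 1 / 2)) = 0 := by
  rw [show (Real.pi : ℂ) * (n + 1 / 2) = Real.pi / 2 + n * Real.pi by ring,
    Complex.cos_antiperiodic.add_nat_mul_eq, Complex.cos_pi_div_two, mul_zero]

theorem cos_pi_mul_nat (n : ℕ) : Complex.cos (Real.pi * (n : ℂ)) ≠ 0 := by
  rw [mul_comm, ← zero_add ((n : ℂ) * Real.pi), Complex.cos_antiperiodic.add_nat_mul_eq,
    Complex.cos_zero, mul_one]
  exact pow_ne_zero _ (by norm_num)

/-- The zero of cos πz is simple: its slope function at c takes the value -π sin πc ≠ 0. -/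
theorem hasResidueAt_secPi_mul {R : ℂ → ℂ} {c : ℂ} (hc : Complex.cos (Real.pi * c) = 0)
    (hR : AnalyticAt ℂ R c) :
    HasResidueAt (fun z => secPi z * R z) c (-R c / Complex.sin (Real.pi * c)) := by
  have hpi : (Real.pi : ℂ) ≠ 0 := by exact_mod_cast Real.pi_ne_zero
  set K : ℂ → ℂ := fun z => Complex.cos (Real.pi * z) with hK
  have hKa : AnalyticAt ℂ K c := by fun_prop
  have hd : HasDerivAt K (-Complex.sin (Real.pi * c) * (Real.pi * 1)) c :=
    ((hasDerivAt_id c).const_mul (Real.pi : ℂ)).ccos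
  have hs : Complex.sin (Real.pi * c) ≠ 0 := by
    intro h
    have := Complex.sin_sq_add_cos_sq (Real.pi * c)
    rw [h, hc] at this
    simp at this
  have hDa : AnalyticAt ℂ (dslope K c) c := by
    obtain ⟨p, hp⟩ := hKa
    exact hp.has_fpower_series_dslope_fslope.analyticAt
  have hDc : dslope K c c = -Complex.sin (Real.pi * c) * Real.pi := by
    rw [dslope_same, hd.deriv, mul_one]
  have hDne : dslope K c c ≠ 0 := by
    rw [hDc]; exact mul_ne_zero (neg_ne_zero.mpr hs) hpi
  have key := HasResidueAt.of_simple (f := fun z => secPi z * R z)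
    (A := fun z => (Real.pi : ℂ) * R z / dslope K c z)
    ((analyticAt_const.mul hR).div hDa hDne) (by
      filter_upwards [self_mem_nhdsWithin] with z hz
      have h2 := sub_smul_dslope K c z
      have h3 : K c = 0 := hc
      rw [h3, sub_zero, smul_eq_mul] at h2
      have h4 : Complex.cos (Real.pi * z) = (z - c) * dslope K c z := h2.symm
      rw [secPi, h4, div_eq_mul_inv, div_eq_mul_inv, mul_inv]
      ring)
  convert key using 1
  rw [hDc]
  field_simp

theorem circleIntegral_secPi_mul {R : ℂ → ℂ} {T : Finset ℂ} (a : ℂ → ℂ) {N : ℕ}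
    (hT : ∀ t ∈ T, t ∈ Metric.ball (0 : ℂ) (N + 1 / 4))
    (hTcos : ∀ t ∈ T, Complex.cos (Real.pi * t) ≠ 0)
    (hR : ∀ z ∈ Metric.closedBall (0 : ℂ) (N + 1 / 4), z ∉ T → AnalyticAt ℂ R z)
    (ha : ∀ t ∈ T, HasResidueAt (fun z => secPi z * R z) t (a t)) :
    (∮ z in C(0, (N + 1 / 4 : ℝ)), secPi z * R z) = 2 * Real.pi * Complex.I *
      (∑ t ∈ T, a t + ∑ n ∈ Finset.range N,
        (-1) ^ (n + 1) * (R (n + 1 / 2) - R (-(n + 1 / 2)))) := by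
  classical
  set P := (Finset.range N).image fun n : ℕ => (n : ℂ) + 1 / 2 with hP
  set Q := (Finset.range N).image fun n : ℕ => -((n : ℂ) + 1 / 2) with hQ
  have hcosN : ∀ n : ℕ, Complex.cos (Real.pi * -((n : ℂ) + 1 / 2)) = 0 := fun n => by
    rw [mul_neg, Complex.cos_neg, cos_pi_mul_nat_add_half]
  have hdiv : ∀ (x : ℂ) (n : ℕ), x / (-1) ^ n = x * (-1) ^ n := fun x n => by
    rw [div_eq_mul_inv, ← inv_pow, show (-1 : ℂ)⁻¹ = -1 by norm_num]
  have hPQcos : ∀ t ∈ P ∪ Q, Complex.cos (Real.pi * t) = 0 := by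
    intro t ht
    rcases Finset.mem_union.mp ht with h | h
    · obtain ⟨n, -, rfl⟩ := Finset.mem_image.mp h
      exact cos_pi_mul_nat_add_half n
    · obtain ⟨n, -, rfl⟩ := Finset.mem_image.mp h
      exact hcosN n
  have hd1 : Disjoint T (P ∪ Q) := by
    rw [Finset.disjoint_left]
    exact fun t h1 h2 => hTcos t h1 (hPQcos t h2)
  have hd2 : Disjoint P Q := by
    rw [Finset.disjoint_left]
    intro t h1 h2
    obtain ⟨n, -, rfl⟩ := Finset.mem_image.mp h1
    obtain ⟨m, -, hm⟩ := Finset.mem_image.mp h2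
    have := congrArg Complex.re hm
    simp at this
    linarith [n.cast_nonneg (α := ℝ), m.cast_nonneg (α := ℝ)]
  have hlt : ∀ n ∈ Finset.range N, ‖(n : ℂ) + 1 / 2‖ < (N + 1 / 4 : ℝ) := by
    intro n hn
    have : (n : ℝ) + 1 ≤ N := by exact_mod_cast Finset.mem_range.mp hn
    rw [norm_natCast_add_half]; linarith
  have hball : ∀ s ∈ T ∪ (P ∪ Q), s ∈ Metric.ball (0 : ℂ) (N + 1 / 4 : ℝ) := by
    intro s hs
    rcases Finset.mem_union.mp hs with h | h
    · exact hT s h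
    rw [mem_ball_zero_iff]
    rcases Finset.mem_union.mp h with h | h
    · obtain ⟨n, hn, rfl⟩ := Finset.mem_image.mp h
      exact hlt n hn
    · obtain ⟨n, hn, rfl⟩ := Finset.mem_image.mp h
      rw [norm_neg]
      exact hlt n hn
  rw [circleIntegral_eq_sum_residues (by positivity)
    (fun z => if z ∈ T then a z else -R z / Complex.sin (Real.pi * z)) (T ∪ (P ∪ Q))]
  · rw [Finset.sum_union hd1, Finset.sum_union hd2]
    congr 2
    · exact Finset.sum_congr rfl fun t ht => if_pos ht
    · rw [hP, hQ, Finset.sum_image fun x _ y _ h => by simpa using h,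
        Finset.sum_image fun x _ y _ h => by simpa using h, ← Finset.sum_add_distrib]
      refine Finset.sum_congr rfl fun n _ => ?_
      rw [if_neg fun h => hTcos _ h (cos_pi_mul_nat_add_half n),
        if_neg fun h => hTcos _ h (hcosN n), mul_neg, Complex.sin_neg, sin_pi_mul_nat_add_half,
        div_neg, hdiv, hdiv, pow_succ]
      ring
  · exact hball
  · intro z hz hzS
    have hz' := hz
    rw [mem_closedBall_zero_iff] at hz
    have hmem : ∀ n : ℕ, ‖(n : ℂ) + 1 / 2‖ ≤ (N + 1 / 4 : ℝ) → n ∈ Finset.range N := by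
      intro n hn
      rw [norm_natCast_add_half] at hn
      by_contra h
      have : (N : ℝ) ≤ n := by exact_mod_cast not_lt.mp (fun h' => h (Finset.mem_range.mpr h'))
      linarith
    simp only [Finset.mem_union, not_or] at hzS
    refine (analyticAt_secPi fun h => ?_).mul (hR z hz' hzS.1)
    obtain ⟨n, rfl | rfl⟩ := cos_pi_mul_eq_zero h
    · exact hzS.2.1 (Finset.mem_image_of_mem _ (hmem n hz))
    · rw [norm_neg] at hz
      exact hzS.2.2 (Finset.mem_image_of_mem (fun n : ℕ => -((n : ℂ) + 1 / 2)) (hmem n hz))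
  · intro s hs
    by_cases hsT : s ∈ T
    · simpa [hsT] using ha s hsT
    · have hs' : s ∈ P ∪ Q := (Finset.mem_union.mp hs).resolve_left hsT
      simpa [hsT] using hasResidueAt_secPi_mul (hPQcos s hs') 
        (hR s (Metric.ball_subset_closedBall (hball s hs)) hsT)

/-- The bound N^{-5/4} on `R` beats the length O(N) of the circle. The set of other poles may grow
with N, which allows `R` to have poles at all naturals. -/
theorem tendsto_sum_residues_secPi_mul {R : ℂ → ℂ} {T : ℕ → Finset ℂ} (a : ℂ → ℂ) {K : ℝ}
    (hT : ∀ᶠ N : ℕ in atTop, ∀ t ∈ T N, t ∈ Metric.ball (0 : ℂ) (N + 1 / 4))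
    (hTcos : ∀ N, ∀ t ∈ T N, Complex.cos (Real.pi * t) ≠ 0)
    (hR : ∀ N : ℕ, ∀ z ∈ Metric.closedBall (0 : ℂ) (N + 1 / 4), z ∉ T N → AnalyticAt ℂ R z)
    (ha : ∀ N, ∀ t ∈ T N, HasResidueAt (fun z => secPi z * R z) t (a t))
    (hK : ∀ᶠ N : ℕ in atTop, ∀ z : ℂ, ‖z‖ = N + 1 / 4 →
      ‖R z‖ ≤ K * ((N : ℝ) + 1) ^ (-(5 / 4) : ℝ)) :
    Tendsto (fun N => ∑ t ∈ T N, a t + ∑ n ∈ Finset.range N,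
      (-1) ^ (n + 1) * (R (n + 1 / 2) - R (-(n + 1 / 2)))) atTop (𝓝 0) := by
  have h2pi : (2 * Real.pi * Complex.I : ℂ) ≠ 0 := by
    have : (Real.pi : ℂ) ≠ 0 := by exact_mod_cast Real.pi_ne_zero
    simp [this]
  have hlim : Tendsto (fun N : ℕ => ∮ z in C(0, (N + 1 / 4 : ℝ)), secPi z * R z) atTop (𝓝 0) := by
    have hb : Tendsto (fun N : ℕ => 4 * Real.pi ^ 2 * K * ((N : ℝ) + 1) ^ (-(1 / 4) : ℝ))
        atTop (𝓝 0) := by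
      have h1 : Tendsto (fun N : ℕ => (N : ℝ) + 1) atTop atTop :=
        tendsto_atTop_add_const_right _ _ tendsto_natCast_atTop_atTop
      simpa using ((tendsto_rpow_neg_atTop (by norm_num : (0 : ℝ) < 1 / 4)).comp h1).const_mul
        (4 * Real.pi ^ 2 * K)
    refine squeeze_zero_norm' ?_ hb
    filter_upwards [hK] with N hN
    -- The sign of `K` is not assumed; the bound is nonnegative because it dominates a norm at one
    -- point of the circle.
    have hB0 : 0 ≤ K * ((N : ℝ) + 1) ^ (-(5 / 4) : ℝ) := by
      refine (norm_nonneg (R ((N + 1 / 4 : ℝ) : ℂ))).trans (hN _ ?_)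
      rw [Complex.norm_real, Real.norm_of_nonneg (by positivity)]
    have h1 := circleIntegral.norm_integral_le_of_norm_le_const (c := (0 : ℂ))
      (R := (N + 1 / 4 : ℝ)) (f := fun z => secPi z * R z)
      (C := 2 * Real.pi * (K * ((N : ℝ) + 1) ^ (-(5 / 4) : ℝ))) (by positivity) (by
        intro z hz
        have hz' : ‖z‖ = N + 1 / 4 := by simpa using hz
        rw [norm_mul]
        exact mul_le_mul (norm_secPi_le hz') (hN z hz') (norm_nonneg _) (by positivity))
    refine h1.trans ?_
    have e : ((N : ℝ) + 1) ^ (-(1 / 4) : ℝ) = ((N : ℝ) + 1) * ((N : ℝ) + 1) ^ (-(5 / 4) : ℝ) := by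
      rw [← Real.rpow_one_add' (by positivity) (by norm_num)]
      norm_num
    rw [e]
    calc _ ≤ 2 * Real.pi * ((N : ℝ) + 1) *
          (2 * Real.pi * (K * ((N : ℝ) + 1) ^ (-(5 / 4) : ℝ))) := by
          gcongr
          norm_num
      _ = _ := by ring
  have h3 := hlim.const_mul (2 * Real.pi * Complex.I : ℂ)⁻¹
  rw [mul_zero] at h3
  refine h3.congr' ?_
  filter_upwards [hT] with N hN
  rw [circleIntegral_secPi_mul a hN (hTcos N) (hR N) (ha N), inv_mul_cancel_left₀ h2pi]

/-! ### Taylor coefficients of the kernel at the naturals. -/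

theorem tendsto_tTildeBar_shift {s : ℕ} (hs : 1 ≤ s) :
    Tendsto (fun N : ℕ => ∑ n ∈ Finset.range N, (-1 : ℂ) ^ (n + 1) * (((n : ℂ) + 1 / 2) ^ s)⁻¹)
      atTop (𝓝 (tTildeBar s : ℂ)) := by
  refine ((Complex.continuous_ofReal.tendsto _).comp (tendsto_tTildeBar hs)).congr fun N => ?_
  simp only [Function.comp_apply]
  rw [← Finset.Ico_add_one_right_eq_Icc, Finset.sum_Ico_eq_sum_range, Complex.ofReal_sum]
  refine Finset.sum_congr (by simp) fun n _ => ?_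
  push_cast
  rw [show (1 : ℂ) + n - 1 / 2 = n + 1 / 2 by ring, add_comm 1 n, div_eq_mul_inv]

theorem tTildeBar_one : tTildeBar 1 = -(Real.pi / 2) := by
  refine tendsto_nhds_unique (tendsto_tTildeBar le_rfl) ?_
  have h := Real.tendsto_sum_pi_div_four.const_mul (-2)
  rw [show -2 * (Real.pi / 4) = -(Real.pi / 2) by ring] at h
  refine h.congr fun N => ?_
  rw [← Finset.Ico_add_one_right_eq_Icc, Finset.sum_Ico_eq_sum_range, Finset.mul_sum]
  refine Finset.sum_congr (by simp) fun n _ => ?_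
  push_cast
  rw [pow_add, pow_one, pow_one, show (1 : ℝ) + n - 1 / 2 = (2 * n + 1) / 2 by ring]
  field_simp

/-- For i ≥ 1, the coefficient is the residue at 0 of secPi(z)·z^{-(i+1)}, and the vanishing of the
total of residues equates it with the sum over half-integers. For i = 0 the factor z^{-1} decays too
slowly, and Leibniz's series for π/4 is used instead. -/
theorem iteratedDeriv_secPi_zero (i : ℕ) :
    iteratedDeriv i secPi 0 / (i.factorial : ℂ) =
      -((1 + (-1) ^ i) * (tTildeBar (i + 1) : ℂ)) := by
  rcases Nat.eq_zero_or_pos i with rfl | hi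
  · simp [secPi, tTildeBar_one]
    ring
  have hcos0 : Complex.cos (Real.pi * 0) ≠ 0 := by simp
  have h := tendsto_sum_residues_secPi_mul (R := fun z => (z ^ (i + 1))⁻¹) (T := fun _ => {0})
    (fun _ => iteratedDeriv i secPi 0 / (i.factorial : ℂ)) (K := 4)
    (Eventually.of_forall fun N => by
      simp only [Finset.mem_singleton, forall_eq]
      exact Metric.mem_ball_self (by positivity))
    (fun N => by simp)
    (fun N z _ hz => by
      have hz0 : z ≠ 0 := by simpa using hz
      have : AnalyticAt ℂ (fun z : ℂ => z ^ (i + 1)) z := by fun_prop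
      exact this.inv (pow_ne_zero _ hz0))
    (fun N => by
      simp only [Finset.mem_singleton, forall_eq]
      refine HasResidueAt.of_pow i (analyticAt_secPi hcos0) (Eventually.of_forall fun z => ?_)
      rw [sub_zero, mul_comm])
    (by
      filter_upwards [eventually_ge_atTop 1] with N hN z hz
      have hN1 : (1 : ℝ) ≤ N := by exact_mod_cast hN
      rw [norm_inv, norm_pow, hz]
      calc (((N : ℝ) + 1 / 4) ^ (i + 1))⁻¹ ≤ (((N : ℝ) + 1 / 4) ^ 2)⁻¹ := by
            gcongr
            · linarith
            · omega
        _ ≤ ((((N : ℝ) + 1) / 2) ^ 2)⁻¹ := by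
            gcongr
            linarith
        _ = 4 * ((N : ℝ) + 1) ^ (-2 : ℝ) := by
            rw [Real.rpow_neg (by positivity), Real.rpow_two]
            field_simp
            norm_num
        _ ≤ _ := by
            gcongr
            · linarith
            · norm_num)
  have h2 := ((tendsto_tTildeBar_shift (s := i + 1) (by omega)).const_mul
    (1 + (-1 : ℂ) ^ i)).const_add (iteratedDeriv i secPi 0 / (i.factorial : ℂ))
  have h3 := tendsto_nhds_unique (h2.congr fun N => ?_) h
  · linear_combination h3
  · rw [Finset.sum_singleton, Finset.mul_sum]
    congr 1
    refine Finset.sum_congr rfl fun n _ => ?_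
    rw [neg_pow ((n : ℂ) + 1 / 2) (i + 1), mul_inv, ← inv_pow (-1 : ℂ),
      show (-1 : ℂ)⁻¹ = -1 by norm_num, pow_succ (-1 : ℂ) i]
    ring

theorem iteratedDeriv_secPi_nat (i n : ℕ) :
    iteratedDeriv i secPi n = (-1) ^ n * iteratedDeriv i secPi 0 := by
  have h1 : (fun z : ℂ => secPi (z + n)) = fun z => (-1) ^ n * secPi z := by
    funext z
    rw [secPi, secPi, mul_add, mul_comm (Real.pi : ℂ) (n : ℂ),
      Complex.cos_antiperiodic.add_nat_mul_eq, div_eq_mul_inv, mul_inv, ← inv_pow,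
      show (-1 : ℂ)⁻¹ = -1 by norm_num]
    ring
  have h2 := congrFun (iteratedDeriv_comp_add_const i secPi (n : ℂ)) 0
  rw [h1, iteratedDeriv_const_mul_field, zero_add] at h2
  exact h2.symm

/-! ### Decay of the rational function and absolute convergence of the series. -/

theorem ratFun_eq (r : RatFunc ℂ) (z : ℂ) : ratFun r z = r.num.eval z / r.denom.eval z := by
  rw [ratFun, RatFunc.eval, Polynomial.eval₂_id, Polynomial.eval₂_id]

theorem analyticAt_ratFun {r : RatFunc ℂ} {z : ℂ} (hz : z ∉ poles r) :
    AnalyticAt ℂ (ratFun r) z := by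
  have hd : r.denom.eval z ≠ 0 := by
    intro h
    exact hz (by rw [poles, Multiset.mem_toFinset, Polynomial.mem_roots r.denom_ne_zero]; exact h)
  rw [show ratFun r = fun z => r.num.eval z / r.denom.eval z from funext (ratFun_eq r)]
  have hP : ∀ P : Polynomial ℂ, AnalyticAt ℂ (fun z => P.eval z) z := fun P =>
    (Polynomial.differentiable P).analyticAt z
  exact (hP _).div (hP _) hd

theorem meromorphicAt_ratFun (r : RatFunc ℂ) (z : ℂ) : MeromorphicAt (ratFun r) z := by
  rw [show ratFun r = fun z => r.num.eval z / r.denom.eval z from funext (ratFun_eq r)]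
  have hP : ∀ P : Polynomial ℂ, AnalyticAt ℂ (fun z => P.eval z) z := fun P =>
    (Polynomial.differentiable P).analyticAt z
  exact (hP _).meromorphicAt.div (hP _).meromorphicAt

theorem exists_norm_ratFun_le {r : RatFunc ℂ}
    (hr : ratFun r =O[Bornology.cobounded ℂ] fun z : ℂ => (z ^ 2)⁻¹) :
    ∃ C X : ℝ, 0 ≤ C ∧ ∀ z : ℂ, X ≤ ‖z‖ → ‖ratFun r z‖ ≤ C * (‖z‖ ^ 2)⁻¹ := by
  obtain ⟨C, hC, h⟩ := hr.exists_nonneg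
  rw [Asymptotics.isBigOWith_iff, ← comap_norm_atTop, eventually_comap] at h
  obtain ⟨X, hX⟩ := eventually_atTop.mp h
  refine ⟨C, X, hC, fun z hz => ?_⟩
  simpa using hX _ hz z rfl

theorem exists_norm_lt_of_mem (S : Finset ℂ) : ∃ X : ℝ, ∀ z ∈ S, ‖z‖ < X := by
  obtain ⟨X, hX⟩ := S.finite_toSet.isBounded.exists_norm_le
  exact ⟨X + 1, fun z hz => (hX z hz).trans_lt (lt_add_one X)⟩

/-- Cauchy's estimate on the unit circle about n transfers the decay O(n^{-2}) from r to each
derivative. -/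
theorem summable_iteratedDeriv_ratFun {r : RatFunc ℂ}
    (hr : ratFun r =O[Bornology.cobounded ℂ] fun z : ℂ => (z ^ 2)⁻¹) (j : ℕ) :
    Summable fun n : ℕ => (-1 : ℂ) ^ n * iteratedDeriv j (ratFun r) (n : ℂ) := by
  obtain ⟨C, X, hC, hX⟩ := exists_norm_ratFun_le hr
  obtain ⟨Y, hY⟩ := exists_norm_lt_of_mem (poles r)
  refine Summable.of_norm_bounded_eventually_nat
    (g := fun n : ℕ => 16 * j.factorial * C * (((n : ℝ) + 1) ^ 2)⁻¹)
    (summable_inv_succ_sq.mul_left _) ?_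
  filter_upwards [eventually_ge_atTop (⌈X⌉₊ + 1), eventually_ge_atTop (⌈Y⌉₊ + 1),
    eventually_ge_atTop 2] with n hnX hnY hn2
  have hnX' : X + 1 ≤ n := by
    have h1 := Nat.le_ceil X
    have h2 : ((⌈X⌉₊ : ℝ) + 1) ≤ n := by exact_mod_cast hnX
    linarith
  have hnY' : Y + 1 ≤ n := by
    have h1 := Nat.le_ceil Y
    have h2 : ((⌈Y⌉₊ : ℝ) + 1) ≤ n := by exact_mod_cast hnY
    linarith
  have hn2' : (2 : ℝ) ≤ n := by exact_mod_cast hn2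
  have hball : ∀ z ∈ Metric.closedBall (n : ℂ) 1, (n : ℝ) - 1 ≤ ‖z‖ := by
    intro z hz
    have h1 := norm_sub_norm_le (n : ℂ) z
    rw [Complex.norm_natCast, norm_sub_rev] at h1
    have h2 : ‖z - n‖ ≤ 1 := by rwa [mem_closedBall_iff_norm] at hz
    linarith
  have hdiff : DiffContOnCl ℂ (ratFun r) (Metric.ball (n : ℂ) 1) := by
    refine DifferentiableOn.diffContOnCl_ball (U := Metric.closedBall (n : ℂ) 1)
      (fun z hz => ?_) subset_rfl
    refine (analyticAt_ratFun fun h => ?_).differentiableAt.differentiableWithinAt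
    linarith [hY z h, hball z hz]
  have key := Complex.norm_iteratedDeriv_le_of_forall_mem_sphere_norm_le j one_pos hdiff
    (C := C * (((n : ℝ) - 1) ^ 2)⁻¹) (by
      intro z hz
      have h1 := hball z (Metric.sphere_subset_closedBall hz)
      refine (hX z (by linarith)).trans ?_
      have : 0 < (n : ℝ) - 1 := by linarith
      gcongr)
  rw [norm_mul, norm_pow, norm_neg, norm_one, one_pow, one_mul]
  refine key.trans ?_
  rw [one_pow, div_one]
  have h1 : (((n : ℝ) - 1) ^ 2)⁻¹ ≤ 16 * (((n : ℝ) + 1) ^ 2)⁻¹ := by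
    rw [show 16 * (((n : ℝ) + 1) ^ 2)⁻¹ = ((((n : ℝ) + 1) / 4) ^ 2)⁻¹ by field_simp; norm_num]
    have : 0 < (n : ℝ) + 1 := by linarith
    gcongr
    linarith
  calc _ ≤ (j.factorial : ℝ) * (C * (16 * (((n : ℝ) + 1) ^ 2)⁻¹)) := by gcongr
    _ = _ := by ring

/-- The exponent is 3/4 - 2 = -5/4. Stating it on an annulus lets it serve both the circles of
radius N + 1/4 and the half-integers of modulus N + 1/2. -/
theorem exists_norm_polygammaNeg_mul_ratFun_le {p : ℕ} (hp : 1 ≤ p) {r : RatFunc ℂ}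
    (hr : ratFun r =O[Bornology.cobounded ℂ] fun z : ℂ => (z ^ 2)⁻¹) :
    ∃ K : ℝ, ∀ᶠ N : ℕ in atTop, ∀ z : ℂ, (N : ℝ) + 1 / 4 ≤ ‖z‖ → ‖z‖ ≤ N + 1 →
      (∀ k : ℕ, (|(k : ℝ) - N| + 1) / 8 ≤ ‖z - k‖) →
      ‖polygammaNeg p z * ratFun r z‖ ≤ K * ((N : ℝ) + 1) ^ (-(5 / 4) : ℝ) := by
  obtain ⟨C, X, hC, hX⟩ := exists_norm_ratFun_le hr
  obtain ⟨D, hD, hD'⟩ := exists_norm_polygammaNeg_le hp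
  refine ⟨4 * D * C, ?_⟩
  filter_upwards [eventually_ge_atTop ⌈X⌉₊, eventually_ge_atTop 1] with N hNX hN1 z h1 h2 h3
  have hNX' : X ≤ N := (Nat.le_ceil X).trans (by exact_mod_cast hNX)
  have hN1' : (1 : ℝ) ≤ N := by exact_mod_cast hN1
  have e1 : (‖z‖ ^ 2)⁻¹ ≤ 4 * ((N : ℝ) + 1) ^ (-2 : ℝ) := by
    rw [Real.rpow_neg (by positivity), Real.rpow_two,
      show 4 * (((N : ℝ) + 1) ^ 2)⁻¹ = ((((N : ℝ) + 1) / 2) ^ 2)⁻¹ by field_simp; norm_num]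
    gcongr
    linarith
  have e2 : ((N : ℝ) + 1) ^ (-(5 / 4) : ℝ) =
      ((N : ℝ) + 1) ^ (3 / 4 : ℝ) * ((N : ℝ) + 1) ^ (-2 : ℝ) := by
    rw [← Real.rpow_add (by positivity)]
    norm_num
  rw [norm_mul, e2]
  calc _ ≤ (D * ((N : ℝ) + 1) ^ (3 / 4 : ℝ)) * (C * (4 * ((N : ℝ) + 1) ^ (-2 : ℝ))) := by
        gcongr
        · exact hD' N z h2 h3
        · exact (hX z (by linarith)).trans (by gcongr)
    _ = _ := by ring

theorem abs_natCast_sub_add_one_div_le (k N : ℕ) {x : ℝ} (h1 : 1 / 4 ≤ x) (h2 : x ≤ 1 / 2) :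
    (|(k : ℝ) - N| + 1) / 8 ≤ |N + x - k| := by
  rcases le_or_gt k N with h | h
  · have h' : (k : ℝ) ≤ N := by exact_mod_cast h
    rw [abs_of_nonpos (by linarith), abs_of_nonneg (by linarith)]
    linarith
  · have h' : (N : ℝ) + 1 ≤ k := by exact_mod_cast h
    rw [abs_of_nonneg (by linarith), abs_of_nonpos (by linarith)]
    linarith

theorem le_norm_sub_natCast {N : ℕ} {z : ℂ} {x : ℝ} (hz : ‖z‖ = N + x) (h1 : 1 / 4 ≤ x)
    (h2 : x ≤ 1 / 2) (k : ℕ) : (|(k : ℝ) - N| + 1) / 8 ≤ ‖z - k‖ := by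
  refine (abs_natCast_sub_add_one_div_le k N h1 h2).trans ?_
  have := abs_norm_sub_norm_le z k
  rwa [hz, Complex.norm_natCast] at this

theorem summable_half_integers {p : ℕ} (hp : 1 ≤ p) {r : RatFunc ℂ}
    (hr : ratFun r =O[Bornology.cobounded ℂ] fun z : ℂ => (z ^ 2)⁻¹) {c : ℕ → ℂ}
    (hc : ∀ n : ℕ, ‖c n‖ = n + 1 / 2) :
    Summable fun n : ℕ => (-1 : ℂ) ^ (n + 1) * (polygammaNeg p (c n) * ratFun r (c n)) := by
  obtain ⟨K, hK⟩ := exists_norm_polygammaNeg_mul_ratFun_le hp hr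
  have hs : Summable fun k : ℕ => ((k : ℝ) + 1) ^ (-(5 / 4) : ℝ) := by
    have := (summable_nat_add_iff 1).mpr
      (Real.summable_nat_rpow.mpr (by norm_num : (-(5 / 4) : ℝ) < -1))
    simpa using this
  refine Summable.of_norm_bounded_eventually_nat (hs.mul_left K) ?_
  filter_upwards [hK] with n hn
  rw [norm_mul, norm_pow, norm_neg, norm_one, one_pow, one_mul]
  exact hn _ (by rw [hc]; linarith) (by rw [hc]; linarith)
    (le_norm_sub_natCast (hc n) (by norm_num) le_rfl)

/-! ### Residues of g at the naturals and the limit of the residue sums. -/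

theorem sum_range_eq_sum_even {M : Type*} [AddCommMonoid M] (F : ℕ → M)
    (hF : ∀ i, Odd i → F i = 0) (m : ℕ) :
    ∑ i ∈ Finset.range (m + 1), F i = ∑ k ∈ Finset.range (m / 2 + 1), F (2 * k) := by
  induction m with
  | zero => simp
  | succ m ih =>
    rw [Finset.sum_range_succ, ih]
    rcases Nat.even_or_odd (m + 1) with h | h
    · obtain ⟨q, hq⟩ := h
      rw [show (m + 1) / 2 + 1 = (m / 2 + 1) + 1 by omega, Finset.sum_range_succ _ (m / 2 + 1)]
      congr 2
      omega
    · rw [hF _ h, add_zero]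
      obtain ⟨q, hq⟩ := h
      rw [show (m + 1) / 2 = m / 2 by omega]

/-- Leibniz's rule with the known coefficients of the kernel; the factor 1 + (-1)^i kills odd orders
and doubles even ones. -/
theorem iteratedDeriv_secPi_mul_nat (m n : ℕ) {f : ℂ → ℂ} (hf : AnalyticAt ℂ f n) :
    iteratedDeriv m (fun z => secPi z * f z) n / (m.factorial : ℂ) =
      -2 * ∑ k ∈ Finset.range (m / 2 + 1), (tTildeBar (2 * k + 1) : ℂ) /
        ((m - 2 * k).factorial : ℂ) * ((-1) ^ n * iteratedDeriv (m - 2 * k) f n) := by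
  have h := iteratedDeriv_mul (n := m) (analyticAt_secPi (cos_pi_mul_nat n)).contDiffAt
    hf.contDiffAt
  change iteratedDeriv m (fun z => secPi z * f z) n = _ at h
  rw [h, Finset.sum_div]
  have h2 : ∀ i ∈ Finset.range (m + 1),
      ((m.choose i : ℂ) * iteratedDeriv i secPi n * iteratedDeriv (m - i) f n) / (m.factorial : ℂ)
      = -((1 + (-1) ^ i) * (tTildeBar (i + 1) : ℂ)) / ((m - i).factorial : ℂ) *
        ((-1) ^ n * iteratedDeriv (m - i) f n) := by
    intro i hi
    have hi' : i ≤ m := Nat.lt_succ_iff.mp (Finset.mem_range.mp hi)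
    rw [iteratedDeriv_secPi_nat, ← iteratedDeriv_secPi_zero, Nat.cast_choose ℂ hi']
    have h1 : (m.factorial : ℂ) ≠ 0 := by exact_mod_cast m.factorial_ne_zero
    have h3 : (i.factorial : ℂ) ≠ 0 := by exact_mod_cast i.factorial_ne_zero
    have h4 : ((m - i).factorial : ℂ) ≠ 0 := by exact_mod_cast (m - i).factorial_ne_zero
    field_simp
  rw [Finset.sum_congr rfl h2, sum_range_eq_sum_even
    (F := fun i => -((1 + (-1) ^ i) * (tTildeBar (i + 1) : ℂ)) / ((m - i).factorial : ℂ) *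
        ((-1) ^ n * iteratedDeriv (m - i) f n)), Finset.mul_sum]
  · refine Finset.sum_congr rfl fun k _ => ?_
    rw [pow_mul]
    norm_num
    ring
  · intro i hi
    rw [hi.neg_one_pow]
    simp

theorem gFun_eq {p : ℕ} (hp : 1 ≤ p) (r : RatFunc ℂ) {z : ℂ} (hz : ∀ k : ℕ, z ≠ k) :
    gFun p r z = secPi z * (polygammaNeg p z * ratFun r z) := by
  rw [gFun, iteratedDeriv_Psi _ hz, Nat.sub_add_cancel hp, secPi]
  have h1 : ((p - 1).factorial : ℂ) ≠ 0 := by exact_mod_cast (p - 1).factorial_ne_zero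
  field_simp

/-- The polygamma factor has the single polar term (z-n)^{-p}; its regular part contributes only an
analytic summand. -/
theorem hasResidueAt_nat {p : ℕ} (hp : 1 ≤ p) {f : ℂ → ℂ} {n : ℕ} (hf : AnalyticAt ℂ f n) :
    HasResidueAt (fun z => secPi z * (polygammaNeg p z * f z)) n
      (iteratedDeriv (p - 1) (fun z => secPi z * f z) n / ((p - 1).factorial : ℂ)) := by
  obtain ⟨H, hH, hpH⟩ := polygammaNeg_principalPart hp n
  have hA : AnalyticAt ℂ (fun z => secPi z * f z) n := (analyticAt_secPi (cos_pi_mul_nat n)).mul hf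
  have h1 := HasResidueAt.of_pow (f := fun z => ((z - n) ^ p)⁻¹ * (secPi z * f z)) (p - 1) hA
    (Eventually.of_forall fun z => by rw [Nat.sub_add_cancel hp])
  refine h1.congr_add (hH.mul hA) (Eventually.of_forall fun z => ?_)
  rw [hpH, Pi.mul_apply]
  ring

theorem tendsto_sum_residues_gFun {p : ℕ} (hp : 1 ≤ p) {r : RatFunc ℂ}
    (hr : ratFun r =O[Bornology.cobounded ℂ] fun z : ℂ => (z ^ 2)⁻¹)
    (hnat : ∀ n : ℕ, (n : ℂ) ∉ poles r) (hcos : ∀ t ∈ poles r, Complex.cos (Real.pi * t) ≠ 0) :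
    Tendsto (fun N : ℕ => ∑ β ∈ poles r, residue (gFun p r) β
      + ∑ n ∈ Finset.range (N + 1),
        iteratedDeriv (p - 1) (fun z => secPi z * ratFun r z) n / ((p - 1).factorial : ℂ)
      + ∑ n ∈ Finset.range N, (-1 : ℂ) ^ (n + 1) *
        (polygammaNeg p (n + 1 / 2) * ratFun r (n + 1 / 2)
          - polygammaNeg p (-(n + 1 / 2)) * ratFun r (-(n + 1 / 2)))) atTop (𝓝 0) := by
  classical
  set R : ℂ → ℂ := fun z => polygammaNeg p z * ratFun r z with hR
  set f : ℂ → ℂ := fun z => secPi z * R z with hf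
  obtain ⟨K, hK⟩ := exists_norm_polygammaNeg_mul_ratFun_le hp hr
  obtain ⟨Y, hY⟩ := exists_norm_lt_of_mem (poles r)
  have hpole : ∀ β ∈ poles r, HasResidueAt f β (residue (gFun p r) β) := by
    intro β hβ
    have hβn : ∀ k : ℕ, β ≠ k := fun k h => hnat k (h ▸ hβ)
    obtain ⟨x, hx⟩ := MeromorphicAt.exists_hasResidueAt (f := f) (c := β)
      ((analyticAt_secPi (hcos β hβ)).meromorphicAt.mul
        ((analyticAt_polygammaNeg hp hβn).meromorphicAt.mul (meromorphicAt_ratFun r β)))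
    have hg : HasResidueAt (gFun p r) β x := by
      refine hx.congr_add (k := fun _ => 0) analyticAt_const ?_
      -- `gFun` is identified with f only off the naturals; near β this suffices.
      have : ∀ᶠ z in 𝓝 β, z ∉ Set.range ((↑) : ℕ → ℂ) :=
        isClosed_range_natCast.isOpen_compl.mem_nhds (by rintro ⟨k, hk⟩; exact hβn k hk.symm)
      filter_upwards [this.filter_mono nhdsWithin_le_nhds] with z hz
      rw [gFun_eq hp r fun k hk => hz ⟨k, hk.symm⟩, add_zero]
    rwa [hg.residue_eq]
  have hn : ∀ n : ℕ, HasResidueAt f n (iteratedDeriv (p - 1) (fun z => secPi z * ratFun r z) n /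
      ((p - 1).factorial : ℂ)) := fun n => hasResidueAt_nat hp (analyticAt_ratFun (hnat n))
  have key := tendsto_sum_residues_secPi_mul (R := R)
    (T := fun N => poles r ∪ (Finset.range (N + 1)).image ((↑) : ℕ → ℂ)) (residue f) (K := K)
    (by
      filter_upwards [eventually_ge_atTop ⌈Y⌉₊] with N hN t ht
      rw [mem_ball_zero_iff]
      rcases Finset.mem_union.mp ht with h | h
      · have h1 : (⌈Y⌉₊ : ℝ) ≤ N := by exact_mod_cast hN
        linarith [hY t h, Nat.le_ceil Y]
      · obtain ⟨n, hn, rfl⟩ := Finset.mem_image.mp h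
        have : (n : ℝ) ≤ N := by exact_mod_cast Nat.lt_succ_iff.mp (Finset.mem_range.mp hn)
        rw [Complex.norm_natCast]
        linarith)
    (fun N t ht => by
      rcases Finset.mem_union.mp ht with h | h
      · exact hcos t h
      · obtain ⟨n, hn, rfl⟩ := Finset.mem_image.mp h
        exact cos_pi_mul_nat n)
    (fun N z hz hzT => by
      simp only [Finset.mem_union, not_or] at hzT
      refine (analyticAt_polygammaNeg hp fun k hk => hzT.2 ?_).mul (analyticAt_ratFun hzT.1)
      rw [mem_closedBall_zero_iff, hk, Complex.norm_natCast] at hz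
      rw [hk]
      refine Finset.mem_image_of_mem _ (Finset.mem_range.mpr (Nat.lt_succ_iff.mpr ?_))
      by_contra! h
      have : (N : ℝ) + 1 ≤ k := by exact_mod_cast h
      linarith)
    (fun N t ht => by
      rcases Finset.mem_union.mp ht with h | h
      · have := hpole t h
        rwa [this.residue_eq]
      · obtain ⟨n, -, rfl⟩ := Finset.mem_image.mp h
        have := hn n
        rwa [this.residue_eq])
    (by
      filter_upwards [hK] with N hN z hz
      exact hN z hz.ge (by rw [hz]; linarith) (le_norm_sub_natCast hz le_rfl (by norm_num)))
  refine key.congr fun N => ?_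
  rw [Finset.sum_union, Finset.sum_image fun x _ y _ h => by exact_mod_cast h]
  · congr 2
    · exact Finset.sum_congr rfl fun β hβ => (hpole β hβ).residue_eq
    · exact Finset.sum_congr rfl fun n _ => (hn n).residue_eq
  · rw [Finset.disjoint_left]
    intro t h1 h2
    obtain ⟨n, -, rfl⟩ := Finset.mem_image.mp h2
    exact hnat n h1

end

/-! ### Assembly of the identity. -/

theorem theorem3p8 (p : ℕ) (hp : 1 ≤ p) (r : RatFunc ℂ)
    (hr : ratFun r =O[Bornology.cobounded ℂ] fun z : ℂ => (z ^ 2)⁻¹)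
    (h_zero : (0 : ℂ) ∉ poles r)
    (h_nat : ∀ n : ℕ+, (n : ℂ) ∉ poles r)
    (h_half : ∀ n : ℕ+, (n : ℂ) - 1 / 2 ∉ poles r ∧ -((n : ℂ) - 1 / 2) ∉ poles r) :
    (Summable fun n : ℕ+ => ((-1 : ℂ) ^ p * (tTilde p : ℂ) + (oddHarmonic p n : ℂ))
        * (-1) ^ (n : ℕ) * ratFun r ((n : ℂ) - 1 / 2)) ∧
    (Summable fun n : ℕ+ => ((tTilde p : ℂ) - (oddHarmonic p (n - 1) : ℂ))
        * (-1) ^ (n : ℕ) * ratFun r (1 / 2 - (n : ℂ))) ∧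
    (∀ k ∈ Finset.range ((p - 1) / 2 + 1),
      Summable fun n : ℕ => (-1 : ℂ) ^ n * iteratedDeriv (p - 1 - 2 * k) (ratFun r) (n : ℂ)) ∧
    (∑' n : ℕ+, ((-1 : ℂ) ^ p * (tTilde p : ℂ) + (oddHarmonic p n : ℂ))
          * (-1) ^ (n : ℕ) * ratFun r ((n : ℂ) - 1 / 2))
      - (-1 : ℂ) ^ p * (∑' n : ℕ+, ((tTilde p : ℂ) - (oddHarmonic p (n - 1) : ℂ))
          * (-1) ^ (n : ℕ) * ratFun r (1 / 2 - (n : ℂ)))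
      - 2 * (∑ k ∈ Finset.range ((p - 1) / 2 + 1),
          (tTildeBar (2 * k + 1) : ℂ) / ((p - 1 - 2 * k).factorial : ℂ)
            * ∑' n : ℕ, (-1 : ℂ) ^ n * iteratedDeriv (p - 1 - 2 * k) (ratFun r) (n : ℂ))
      + (∑ β ∈ poles r, residue (gFun p r) β) = 0 := by
  have hnat : ∀ n : ℕ, (n : ℂ) ∉ poles r := by
    intro n
    rcases Nat.eq_zero_or_pos n with rfl | h
    · simpa using h_zero
    · exact h_nat ⟨n, h⟩
  have hcos : ∀ t ∈ poles r, Complex.cos (Real.pi * t) ≠ 0 := by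
    intro t ht h
    obtain ⟨n, hn⟩ := cos_pi_mul_eq_zero h
    have h2 := h_half n.succPNat
    rw [Nat.succPNat_coe, Nat.succ_eq_add_one, Nat.cast_add_one,
      show (n : ℂ) + 1 - 1 / 2 = n + 1 / 2 by ring] at h2
    rcases hn with rfl | rfl
    · exact h2.1 ht
    · exact h2.2 ht
  set u : ℕ → ℂ := fun n => ((-1 : ℂ) ^ p * (tTilde p : ℂ) + (oddHarmonic p n : ℂ))
        * (-1) ^ n * ratFun r ((n : ℂ) - 1 / 2) with hu
  -- The truncated n - 1 at n = 0 is harmless: only the values `v (n + 1)` occur.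
  set v : ℕ → ℂ := fun n => ((tTilde p : ℂ) - (oddHarmonic p (n - 1) : ℂ))
        * (-1) ^ n * ratFun r (1 / 2 - (n : ℂ)) with hv
  have hneg : (-1 : ℂ) ^ p * (-1) ^ p = 1 := by rw [← mul_pow]; norm_num
  have hu1 : ∀ n : ℕ, (-1 : ℂ) ^ (n + 1) *
      (polygammaNeg p (n + 1 / 2) * ratFun r (n + 1 / 2)) = u (n + 1) := by
    intro n
    have h := polygammaNeg_nat_sub_half hp (n + 1)
    simp only [hu]
    rw [← h]
    push_cast
    rw [show (n : ℂ) + 1 - 1 / 2 = n + 1 / 2 by ring]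
    ring
  have hv1 : ∀ n : ℕ, (-1 : ℂ) ^ (n + 1) *
      (polygammaNeg p (-(n + 1 / 2)) * ratFun r (-(n + 1 / 2))) = (-1) ^ p * v (n + 1) := by
    intro n
    simp only [hv]
    rw [polygammaNeg_neg_nat_add_half hp, Nat.add_sub_cancel]
    push_cast
    rw [show (1 : ℂ) / 2 - (n + 1) = -(n + 1 / 2) by ring]
    ring
  have hus : Summable fun n => u (n + 1) :=
    (summable_half_integers hp hr norm_natCast_add_half).congr hu1
  have hvs' : Summable fun n => (-1) ^ p * v (n + 1) :=
    (summable_half_integers hp hr (c := fun n => -((n : ℂ) + 1 / 2))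
      fun n => by rw [norm_neg, norm_natCast_add_half]).congr hv1
  have hvs : Summable fun n => v (n + 1) := by
    refine (hvs'.mul_left ((-1) ^ p)).congr fun n => ?_
    rw [← mul_assoc, hneg, one_mul]
  have hw : ∀ j : ℕ, Summable fun n : ℕ => (-1 : ℂ) ^ n * iteratedDeriv j (ratFun r) (n : ℂ) :=
    summable_iteratedDeriv_ratFun hr
  refine ⟨summable_pnat_iff_summable_succ.mpr hus, summable_pnat_iff_summable_succ.mpr hvs,
    fun k _ => hw _, ?_⟩
  change (∑' n : ℕ+, u n) - (-1 : ℂ) ^ p * (∑' n : ℕ+, v n) - _ + _ = 0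
  rw [tsum_pnat_eq_tsum_succ (f := u), tsum_pnat_eq_tsum_succ (f := v)]
  -- The residue sums tend to 0 and also, term by term, to the left-hand side. The derivative series
  -- is shifted by one because the disc of radius N + 1/4 contains the N + 1 naturals 0, ..., N but
  -- only N half-integers of each sign.
  refine tendsto_nhds_unique (Tendsto.congr (fun N => ?_)
    (((hus.hasSum.tendsto_sum_nat.sub (hvs.hasSum.tendsto_sum_nat.const_mul ((-1) ^ p))).sub
      ((tendsto_finsetSum _ fun k _ =>
        (((tendsto_add_atTop_iff_nat 1).mpr (hw (p - 1 - 2 * k)).hasSum.tendsto_sum_nat).const_mul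
          ((tTildeBar (2 * k + 1) : ℂ) / ((p - 1 - 2 * k).factorial : ℂ)))).const_mul 2)).add_const
      (∑ β ∈ poles r, residue (gFun p r) β)))
    (tendsto_sum_residues_gFun hp hr hnat hcos)
  have e1 : ∑ n ∈ Finset.range (N + 1),
      iteratedDeriv (p - 1) (fun z => secPi z * ratFun r z) n / ((p - 1).factorial : ℂ)
      = -2 * ∑ k ∈ Finset.range ((p - 1) / 2 + 1),
          (tTildeBar (2 * k + 1) : ℂ) / ((p - 1 - 2 * k).factorial : ℂ) *
          ∑ n ∈ Finset.range (N + 1), (-1) ^ n * iteratedDeriv (p - 1 - 2 * k) (ratFun r) n := by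
    simp_rw [Finset.mul_sum]
    rw [Finset.sum_comm]
    refine Finset.sum_congr rfl fun n _ => ?_
    rw [iteratedDeriv_secPi_mul_nat _ _ (analyticAt_ratFun (hnat n)), Finset.mul_sum]
  have e2 : ∑ n ∈ Finset.range N, (-1 : ℂ) ^ (n + 1) *
        (polygammaNeg p (n + 1 / 2) * ratFun r (n + 1 / 2)
          - polygammaNeg p (-(n + 1 / 2)) * ratFun r (-(n + 1 / 2)))
      = ∑ n ∈ Finset.range N, u (n + 1) - (-1) ^ p * ∑ n ∈ Finset.range N, v (n + 1) := by
    rw [Finset.mul_sum, ← Finset.sum_sub_distrib]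
    refine Finset.sum_congr rfl fun n _ => ?_
    rw [mul_sub, hu1, hv1]
  rw [e1, e2]
  ring
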